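/- Let $\mathbb K$ be $\mathbb R$ or $\mathbb C$, let $G$ be a locally compact Hausdorff group with a fixed left Haar measure $ds$, and let $\mathcal X$ be a non-empty class of Banach spaces over $\mathbb K$. Let $\mathcal R$ be the class of all isometric strongly continuous representations of $G$ in spaces from $\mathcal X$, i.e. of all pairs $(X,U)$ where $X\in\mathcal X$ and $U$ is a homomorphism from $G$ into the group of invertible bounded operators on $X$ such that $r\mapsto U_rx$ is continuous for all $x\in X$ and $\|U_rx\|=\|x\|$ for all $r\in G$, $x\in X$. For $(X,U)\in\mathcal R$ and $f\in C_c(G)$ ($\mathbb K$-valued) put $U(f)x=\int_G f(s)U_sx\,ds$ $(x\in X)$. Equip $C_c(G)$ with the convolution product $(f*g)(s)=\int_G f(r)g(r^{-1}s)\,dr$ and the algebra seminorm $\sigma^{\mathcal R}(f)=\sup_{U\in\mathcal R}\|U(f)\|$. Let the group Banach algebra $\mathcal B_{\mathcal X}(G)=(\mathbb K\rtimes_{\mathrm{triv}}G)^{\mathcal R}$ be the Banach algebra obtained as the completion of $C_c(G)/\ker\sigma^{\mathcal R}$ in the norm induced by $\sigma^{\mathcal R}$, with canonical homomorphism $q^{\mathcal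 R}:C_c(G)\to\mathcal B_{\mathcal X}(G)$. For $U\in\mathcal R$ on $X$, let $U^{\mathcal R}:\mathcal B_{\mathcal X}(G)\to B(X)$ be the bounded representation determined by $U^{\mathcal R}(q^{\mathcal R}(f))=U(f)$ for all $f\in C_c(G)$. Then $U\mapsto U^{\mathcal R}$ (which keeps the representation space) is a bijection from $\mathcal R$ onto the class of all non-degenerate contractive representations of $\mathcal B_{\mathcal X}(G)$ in spaces from $\mathcal X$, i.e. of all pairs $(X,T)$ where $X\in\mathcal X$ and $T:\mathcal B_{\mathcal X}(G)\to B(X)$ is an algebra homomorphism such that $\|T(a)\|\le\|a\|$ for all $a$ and the linear span of all $T(a)x$ is dense in $X$. Moreover, for $U\in\mathcal R$, a closed subspace of the representation space is invariant under all $U_r$ $(r\in G)$ if and only if it is invariant under all $U^{\mathcal R}(a)$ $(a\in\mathcal B_{\mathcal X}(G))$; and for $U,V\in\mathcal R$ on $X$ and $Y$, a bounded operator $\Phi:X\to Y$ satisfies $V_r\Phi=\Phi U_r$ for all $r\in G$ if and only if $V^{\mathcal R}(a)\Phi=\Phi U^{\mathcal R}(a)$ for all $a\in\mathcal B_{\mathcal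 X}(G)$, so that the Banach spaces of bounded intertwining operators coincide. -/

import Mathlib

universe w u v

noncomputable section


open MeasureTheory Function Set

namespace BanachCrossed

/-! ### Banach spaces and representations -/

/-- A Banach space over `𝕜`; a class of Banach spaces is a `Set (BanachSpace 𝕜)`. -/
structure BanachSpace (𝕜 : Type w) [RCLike 𝕜] : Type (max w (v + 1)) where
  /-- the underlying type -/
  carrier : Type v
  [normedAddCommGroup : NormedAddCommGroup carrier]
  [normedSpace : NormedSpace 𝕜 carrier]
  [completeSpace : CompleteSpace carrier]

instance (𝕜 : Type w) [RCLike 𝕜] : CoeSort (BanachSpace.{w, v} 𝕜) (Type v) :=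
  ⟨BanachSpace.carrier⟩

attribute [instance] BanachSpace.normedAddCommGroup BanachSpace.normedSpace
  BanachSpace.completeSpace

/-- The underlying real structure, needed only to form Bochner integrals. -/
instance BanachSpace.realNormedSpace {𝕜 : Type w} [RCLike 𝕜] (X : BanachSpace.{w, v} 𝕜) :
    NormedSpace ℝ X :=
  NormedSpace.restrictScalars ℝ 𝕜 X

instance BanachSpace.realScalarTower {𝕜 : Type w} [RCLike 𝕜] (X : BanachSpace.{w, v} 𝕜) :
    IsScalarTower ℝ 𝕜 X :=
  RestrictScalars.isScalarTower ℝ 𝕜 X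

/-- A strongly continuous representation of `G` on the Banach space `X`: a group homomorphism
into the invertible bounded operators such that `r ↦ U_r x` is continuous for every `x`. -/
@[ext]
structure StrongRep (𝕜 : Type w) [RCLike 𝕜] (G : Type u) [Group G] [TopologicalSpace G]
    (X : BanachSpace.{w, v} 𝕜) where
  /-- the homomorphism into the group of invertible bounded operators -/
  hom : G →* (X →L[𝕜] X)ˣ
  continuous_apply : ∀ x : X, Continuous fun r : G => (hom r : X →L[𝕜] X) x

section GroupReps

variable {𝕜 : Type w} [RCLike 𝕜] {G : Type u} [Group G] [TopologicalSpace G]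
  {X Y : BanachSpace.{w, v} 𝕜}

/-- The bounded operator `U_r`. -/
def StrongRep.op (U : StrongRep 𝕜 G X) (r : G) : X →L[𝕜] X := (U.hom r : X →L[𝕜] X)

/-- `U` acts by isometries. -/
def StrongRep.IsIsometric (U : StrongRep 𝕜 G X) : Prop :=
  ∀ (r : G) (x : X), ‖U.op r x‖ = ‖x‖

/-- The closed subspaces invariant under all `U_r`. -/
def StrongRep.closedInvariantSubspaces (U : StrongRep 𝕜 G X) : Set (Submodule 𝕜 X) :=
  {Z | IsClosed (Z : Set X) ∧ ∀ (r : G), ∀ z ∈ Z, U.op r z ∈ Z}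

/-- The bounded intertwining operators between `U` and `V`, as a subspace of the bounded
operators from `X` to `Y` with the operator norm. -/
def StrongRep.intertwiners (U : StrongRep 𝕜 G X) (V : StrongRep 𝕜 G Y) :
    Submodule 𝕜 (X →L[𝕜] Y) where
  carrier := {Φ | ∀ r : G, (V.op r).comp Φ = Φ.comp (U.op r)}
  add_mem' := by
    intro Φ Ψ hΦ hΨ r
    simp only [mem_ofPred_eq] at hΦ hΨ
    rw [ContinuousLinearMap.comp_add, ContinuousLinearMap.add_comp, hΦ r, hΨ r]
  zero_mem' := by
    intro r
    simp
  smul_mem' := by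
    intro c Φ hΦ r
    simp only [mem_ofPred_eq] at hΦ
    rw [ContinuousLinearMap.comp_smul, ContinuousLinearMap.smul_comp, hΦ r]

/-- The trivial representation. -/
def StrongRep.trivial (𝕜 : Type w) [RCLike 𝕜] (G : Type u) [Group G] [TopologicalSpace G]
    (X : BanachSpace.{w, v} 𝕜) : StrongRep 𝕜 G X where
  hom := 1
  continuous_apply := fun x => by simpa using continuous_const

end GroupReps

section AlgebraReps

variable {𝕜 : Type w} [RCLike 𝕜] {A : Type u} [NonUnitalNormedRing A] [NormedSpace 𝕜 A]
  {X Y : BanachSpace.{w, v} 𝕜}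

/-- A representation of the (possibly non-unital) algebra `A` on `X` is an algebra homomorphism
from `A` into the bounded operators on `X`; neither boundedness nor unitality is required. -/
abbrev AlgRep (𝕜 : Type w) [RCLike 𝕜] (A : Type u) [NonUnitalNormedRing A] [NormedSpace 𝕜 A]
    (X : BanachSpace.{w, v} 𝕜) :=
  A →ₙₐ[𝕜] (X →L[𝕜] X)

/-- The linear span of all `T(a)x` is dense in `X`. -/
def AlgRep.IsNondegenerate (T : AlgRep 𝕜 A X) : Prop :=
  Dense (Submodule.span 𝕜 {y : X | ∃ (a : A) (x : X), T a x = y} : Set X)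

/-- `T` has norm at most one. -/
def AlgRep.IsContractive (T : AlgRep 𝕜 A X) : Prop :=
  ∀ a : A, ‖T a‖ ≤ ‖a‖

/-- The closed subspaces invariant under all `T(a)`. -/
def AlgRep.closedInvariantSubspaces (T : AlgRep 𝕜 A X) : Set (Submodule 𝕜 X) :=
  {Z | IsClosed (Z : Set X) ∧ ∀ (a : A), ∀ z ∈ Z, T a z ∈ Z}

/-- The bounded intertwining operators between `T` and `S`, as a subspace of the bounded
operators from `X` to `Y` with the operator norm. -/
def AlgRep.intertwiners (T : AlgRep 𝕜 A X) (S : AlgRep 𝕜 A Y) :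
    Submodule 𝕜 (X →L[𝕜] Y) where
  carrier := {Φ | ∀ a : A, (S a).comp Φ = Φ.comp (T a)}
  add_mem' := by
    intro Φ Ψ hΦ hΨ a
    simp only [mem_ofPred_eq] at hΦ hΨ
    rw [ContinuousLinearMap.comp_add, ContinuousLinearMap.add_comp, hΦ a, hΨ a]
  zero_mem' := by
    intro a
    simp
  smul_mem' := by
    intro c Φ hΦ a
    simp only [mem_ofPred_eq] at hΦ
    rw [ContinuousLinearMap.comp_smul, ContinuousLinearMap.smul_comp, hΦ a]

/-- All pairs `(X, T)` with `X` in the class `𝓧` and `T` a non-degenerate contractive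
representation of `A` on `X`. -/
def ndContractiveReps (A : Type u) [NonUnitalNormedRing A] [NormedSpace 𝕜 A]
    (𝓧 : Set (BanachSpace.{w, v} 𝕜)) : Set (Σ X : BanachSpace.{w, v} 𝕜, AlgRep 𝕜 A X) :=
  {T | T.1 ∈ 𝓧 ∧ AlgRep.IsNondegenerate T.2 ∧ AlgRep.IsContractive T.2}

end AlgebraReps

/-! ### The convolution algebra -/

/-- The space of compactly supported continuous functions on `G`, to be equipped with the
convolution product with respect to `μ`. -/
def ConvAlgebra (𝕜 : Type w) [RCLike 𝕜] (G : Type u) [TopologicalSpace G] [MeasurableSpace G]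
    (_μ : Measure G) : Type (max u w) :=
  CompactlySupportedContinuousMap G 𝕜

section Conv

variable {𝕜 : Type w} [RCLike 𝕜] {G : Type u} [Group G] [TopologicalSpace G]
  [IsTopologicalGroup G] [LocallyCompactSpace G] [MeasurableSpace G] [BorelSpace G]
  {μ : Measure G}

instance : AddCommGroup (ConvAlgebra 𝕜 G μ) :=
  inferInstanceAs (AddCommGroup (CompactlySupportedContinuousMap G 𝕜))

instance : Module 𝕜 (ConvAlgebra 𝕜 G μ) :=
  inferInstanceAs (Module 𝕜 (CompactlySupportedContinuousMap G 𝕜))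

instance : FunLike (ConvAlgebra 𝕜 G μ) G 𝕜 :=
  inferInstanceAs (FunLike (CompactlySupportedContinuousMap G 𝕜) G 𝕜)

namespace ConvAlgebra

@[ext]
theorem ext {f g : ConvAlgebra 𝕜 G μ} (h : ∀ s, f s = g s) : f = g :=
  DFunLike.ext _ _ h

theorem continuous (f : ConvAlgebra 𝕜 G μ) : Continuous f :=
  ContinuousMap.continuous (CompactlySupportedContinuousMap.toContinuousMap f)

theorem hasCompactSupport (f : ConvAlgebra 𝕜 G μ) : HasCompactSupport f :=
  CompactlySupportedContinuousMap.hasCompactSupport' f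

@[simp] theorem add_apply (f g : ConvAlgebra 𝕜 G μ) (s : G) : (f + g) s = f s + g s := rfl

@[simp] theorem zero_apply (s : G) : (0 : ConvAlgebra 𝕜 G μ) s = 0 := rfl

@[simp] theorem smul_apply (c : 𝕜) (f : ConvAlgebra 𝕜 G μ) (s : G) : (c • f) s = c * f s := rfl

section Integral

variable {E : Type*} [NormedAddCommGroup E] [NormedSpace 𝕜 E]

theorem integrable_smul [IsFiniteMeasureOnCompacts μ] (f : ConvAlgebra 𝕜 G μ) {F : G → E}
    (hF : Continuous F) : Integrable (fun s => f s • F s) μ :=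
  (f.continuous.smul hF).integrable_of_hasCompactSupport f.hasCompactSupport.smul_right

end Integral

variable [μ.IsHaarMeasure]

theorem continuous_conv (f g : ConvAlgebra 𝕜 G μ) :
    Continuous fun s => ∫ r, f r * g (r⁻¹ * s) ∂μ := by
  rw [← continuousOn_univ]
  refine continuousOn_integral_of_compact_support (k := tsupport f) f.hasCompactSupport ?_ ?_
  · refine Continuous.continuousOn ?_
    exact (f.continuous.comp continuous_snd).mul
      (g.continuous.comp (continuous_snd.inv.mul continuous_fst))
  · intro p x _ hx
    rw [image_eq_zero_of_notMem_tsupport hx, zero_mul]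

theorem hasCompactSupport_conv (f g : ConvAlgebra 𝕜 G μ) :
    HasCompactSupport fun s => ∫ r, f r * g (r⁻¹ * s) ∂μ := by
  refine HasCompactSupport.of_support_subset_isCompact
    (IsCompact.image (f.hasCompactSupport.prod g.hasCompactSupport) continuous_mul) ?_
  intro s hs
  by_contra hn
  apply hs
  have : ∀ r, f r * g (r⁻¹ * s) = 0 := by
    intro r
    by_contra hr
    apply hn
    refine ⟨(r, r⁻¹ * s), ⟨subset_tsupport _ (left_ne_zero_of_mul hr),
      subset_tsupport _ (right_ne_zero_of_mul hr)⟩, by simp⟩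
  simp [this]

/-- The convolution product `(f * g)(s) = ∫ f(r) g(r⁻¹ s) dr`. -/
instance : Mul (ConvAlgebra 𝕜 G μ) where
  mul f g :=
    ({ toFun := fun s => ∫ r, f r * g (r⁻¹ * s) ∂μ
       continuous_toFun := continuous_conv f g
       hasCompactSupport' := hasCompactSupport_conv f g } :
      CompactlySupportedContinuousMap G 𝕜)

theorem mul_apply (f g : ConvAlgebra 𝕜 G μ) (s : G) :
    (f * g) s = ∫ r, f r * g (r⁻¹ * s) ∂μ := rfl

/-- Fubini for the convolution product. -/
theorem integral_mul_smul {E : Type*} [NormedAddCommGroup E] [NormedSpace 𝕜 E]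
    [NormedSpace ℝ E] [IsScalarTower ℝ 𝕜 E] [CompleteSpace E]
    (f g : ConvAlgebra 𝕜 G μ) {F : G → E} (hF : Continuous F) :
    ∫ s, (f * g) s • F s ∂μ = ∫ r, f r • ∫ s, g s • F (r * s) ∂μ ∂μ := by
  have h1 : ∀ s, (f * g) s • F s = ∫ r, (f r * g (r⁻¹ * s)) • F s ∂μ := by
    intro s
    rw [mul_apply, integral_smul_const]
  have h2 : ∀ r, f r • ∫ s, g s • F (r * s) ∂μ = ∫ s, (f r * g (r⁻¹ * s)) • F s ∂μ := by
    intro r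
    rw [← integral_mul_left_eq_self (fun s => (f r * g (r⁻¹ * s)) • F s) r, ← integral_smul]
    simp [mul_smul]
  simp_rw [h1, h2]
  refine integral_integral_swap_of_hasCompactSupport (f := fun s r =>
    (f r * g (r⁻¹ * s)) • F s) ?_ ?_
  · exact ((f.continuous.comp continuous_snd).mul
      (g.continuous.comp (continuous_snd.inv.mul continuous_fst))).smul
      (hF.comp continuous_fst)
  · refine HasCompactSupport.of_support_subset_isCompact
      (IsCompact.image (f.hasCompactSupport.prod g.hasCompactSupport)
        (f := fun p : G × G => (p.1 * p.2, p.1)) (by fun_prop)) ?_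
    rintro ⟨s, r⟩ hs
    have hs' : (f r * g (r⁻¹ * s)) • F s ≠ 0 := hs
    have hne : f r * g (r⁻¹ * s) ≠ 0 := fun h0 => hs' (by rw [h0, zero_smul])
    refine ⟨(r, r⁻¹ * s), ⟨subset_tsupport _ (left_ne_zero_of_mul hne),
      subset_tsupport _ (right_ne_zero_of_mul hne)⟩, by simp⟩

theorem integrable_conv (f g : ConvAlgebra 𝕜 G μ) (s : G) :
    Integrable (fun r => f r * g (r⁻¹ * s)) μ :=
  f.integrable_smul (g.continuous.comp (continuous_inv.mul continuous_const))

instance : NonUnitalRing (ConvAlgebra 𝕜 G μ) :=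
  { (inferInstance : AddCommGroup (ConvAlgebra 𝕜 G μ)),
    (inferInstance : Mul (ConvAlgebra 𝕜 G μ)) with
    left_distrib := by
      intro f g h
      ext s
      simp only [mul_apply, add_apply, mul_add]
      exact integral_add (integrable_conv f g s) (integrable_conv f h s)
    right_distrib := by
      intro f g h
      ext s
      simp only [mul_apply, add_apply, add_mul]
      exact integral_add (integrable_conv f h s) (integrable_conv g h s)
    zero_mul := by
      intro f
      ext s
      simp [mul_apply]
    mul_zero := by
      intro f
      ext s
      simp [mul_apply]
    mul_assoc := by
      intro f g h
      ext t
      have := integral_mul_smul f g (F := fun s => h (s⁻¹ * t))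
        (h.continuous.comp (continuous_inv.mul continuous_const))
      simp only [smul_eq_mul, mul_inv_rev] at this
      rw [mul_apply, this, mul_apply]
      simp only [mul_apply, mul_assoc] }

instance : IsScalarTower 𝕜 (ConvAlgebra 𝕜 G μ) (ConvAlgebra 𝕜 G μ) where
  smul_assoc := by
    intro c f g
    ext s
    simp only [smul_eq_mul, smul_apply, mul_apply, mul_assoc]
    exact integral_const_mul _ _

instance : SMulCommClass 𝕜 (ConvAlgebra 𝕜 G μ) (ConvAlgebra 𝕜 G μ) where
  smul_comm := by
    intro c f g
    ext s
    simp only [smul_eq_mul, smul_apply, mul_apply, mul_left_comm _ c]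
    exact (integral_const_mul _ _).symm

end ConvAlgebra

/-! ### Integrated forms -/

variable {X : BanachSpace.{w, v} 𝕜}

theorem StrongRep.norm_integral_le [IsFiniteMeasureOnCompacts μ] (U : StrongRep 𝕜 G X)
    (f : ConvAlgebra 𝕜 G μ) {M : ℝ}
    (hM : ∀ s ∈ tsupport f, ‖U.op s‖ ≤ M) (x : X) :
    ‖∫ s, f s • U.op s x ∂μ‖ ≤ ((∫ s, ‖f s‖ ∂μ) * M) * ‖x‖ := by
  have hf : Integrable (fun s => ‖f s‖) μ :=
    (f.continuous.integrable_of_hasCompactSupport f.hasCompactSupport).norm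
  rw [← integral_mul_const, ← integral_mul_const]
  refine norm_integral_le_of_norm_le ((hf.mul_const _).mul_const _)
    (Filter.Eventually.of_forall fun s => ?_)
  rw [norm_smul, mul_assoc]
  by_cases hs : s ∈ tsupport f
  · exact mul_le_mul_of_nonneg_left
      (((U.op s).le_opNorm x).trans (mul_le_mul_of_nonneg_right (hM s hs) (norm_nonneg _)))
      (norm_nonneg _)
  · simp [image_eq_zero_of_notMem_tsupport hs]

theorem StrongRep.exists_bound (U : StrongRep 𝕜 G X) {K : Set G} (hK : IsCompact K) :
    ∃ M : ℝ, ∀ s ∈ K, ‖U.op s‖ ≤ M := by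
  obtain ⟨M, hM⟩ := banach_steinhaus (g := fun s : K => U.op s) (fun x => by
    obtain ⟨C, hC⟩ := hK.exists_bound_of_continuousOn (U.continuous_apply x).continuousOn
    exact ⟨C, fun s => hC s s.2⟩)
  exact ⟨M, fun s hs => hM ⟨s, hs⟩⟩

variable [μ.IsHaarMeasure]

/-- The operator `U(f)`, given by `U(f)x = ∫ f(s) U_s x ds`. -/
def StrongRep.integralOp (U : StrongRep 𝕜 G X) (f : ConvAlgebra 𝕜 G μ) : X →L[𝕜] X :=
  LinearMap.mkContinuousOfExistsBound
    { toFun := fun x => ∫ s, f s • U.op s x ∂μ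
      map_add' := fun x y => by
        simp only [map_add, smul_add]
        exact integral_add (f.integrable_smul (U.continuous_apply x))
          (f.integrable_smul (U.continuous_apply y))
      map_smul' := fun c x => by
        simp only [map_smul, smul_comm _ c, RingHom.id_apply]
        exact integral_smul c _ }
    (by
      obtain ⟨M, hM⟩ := U.exists_bound f.hasCompactSupport.isCompact
      exact ⟨_, U.norm_integral_le f hM⟩)

theorem StrongRep.integralOp_apply (U : StrongRep 𝕜 G X) (f : ConvAlgebra 𝕜 G μ) (x : X) :
    U.integralOp f x = ∫ s, f s • U.op s x ∂μ := rfl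

/-- The integrated form `f ↦ U(f)` of `U`, a representation of the convolution algebra. -/
def StrongRep.integrated (μ : Measure G) [μ.IsHaarMeasure] (U : StrongRep 𝕜 G X) :
    ConvAlgebra 𝕜 G μ →ₙₐ[𝕜] (X →L[𝕜] X) where
  toFun := U.integralOp
  map_smul' := fun c f => by
    ext x
    simp only [integralOp_apply, ConvAlgebra.smul_apply, mul_smul, MonoidHom.id_apply,
      _root_.smul_apply]
    exact integral_smul c _
  map_zero' := by
    ext x
    simp [integralOp_apply]
  map_add' := fun f g => by
    ext x
    simp only [integralOp_apply, ConvAlgebra.add_apply, add_smul,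
      _root_.add_apply]
    exact integral_add (f.integrable_smul (U.continuous_apply x))
      (g.integrable_smul (U.continuous_apply x))
  map_mul' := fun f g => by
    ext x
    have h := ConvAlgebra.integral_mul_smul f g (F := fun s => U.op s x)
      (U.continuous_apply x)
    rw [integralOp_apply, h]
    simp only [mul_apply_eq_comp, integralOp_apply]
    congr 1
    ext r
    congr 1
    refine Eq.trans ?_ (ContinuousLinearMap.integral_comp_comm (U.op r)
      (g.integrable_smul (U.continuous_apply x)))
    congr 1
    ext s
    simp [op, map_mul]

theorem StrongRep.integrated_apply (U : StrongRep 𝕜 G X) (f : ConvAlgebra 𝕜 G μ) (x : X) :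
    U.integrated μ f x = ∫ s, f s • U.op s x ∂μ := rfl

end Conv

/-! ### The crossed product associated with a class of representations -/

/-- A non-empty class of strongly continuous representations of `G` on Banach spaces which is
uniformly bounded: there is `ν : G → [0, ∞)`, bounded on compact sets, with `‖U_r‖ ≤ ν r` for
all `U` in the class and all `r`. -/
structure RepClass (𝕜 : Type w) [RCLike 𝕜] (G : Type u) [Group G] [TopologicalSpace G] where
  /-- the members of the class -/
  reps : Set (Σ X : BanachSpace.{w, v} 𝕜, StrongRep 𝕜 G X)
  nonempty : reps.Nonempty
  bounded : ∃ ν : G → NNReal, (∀ K : Set G, IsCompact K → BddAbove (ν '' K)) ∧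
    ∀ U ∈ reps, ∀ r : G, ‖U.2.op r‖ ≤ ν r

section Crossed

variable {𝕜 : Type w} [RCLike 𝕜] {G : Type u} [Group G] [TopologicalSpace G]
  [IsTopologicalGroup G] [LocallyCompactSpace G] [MeasurableSpace G] [BorelSpace G]
  {μ : Measure G} [μ.IsHaarMeasure]

/-- The seminorm `σ(f) = sup ‖U(f)‖`, the supremum being over all `U` in the class. -/
def RepClass.sigma (R : RepClass.{w, u, v} 𝕜 G) (f : ConvAlgebra 𝕜 G μ) : ℝ :=
  ⨆ U : R.reps, ‖U.1.2.integrated μ f‖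

theorem RepClass.bddAbove (R : RepClass.{w, u, v} 𝕜 G) (f : ConvAlgebra 𝕜 G μ) :
    BddAbove (range fun U : R.reps => ‖U.1.2.integrated μ f‖) := by
  obtain ⟨ν, hν, hR⟩ := R.bounded
  obtain ⟨M, hM⟩ := hν _ f.hasCompactSupport.isCompact
  refine ⟨(∫ s, ‖f s‖ ∂μ) * M, ?_⟩
  rintro _ ⟨U, rfl⟩
  refine ContinuousLinearMap.opNorm_le_bound _
    (mul_nonneg (integral_nonneg fun _ => norm_nonneg _) M.2) fun x => ?_
  refine U.1.2.norm_integral_le f (fun s hs => (hR _ U.2 s).trans ?_) x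
  exact_mod_cast hM (mem_image_of_mem ν hs)

theorem RepClass.norm_le_sigma (R : RepClass.{w, u, v} 𝕜 G) (f : ConvAlgebra 𝕜 G μ)
    {U : Σ X : BanachSpace.{w, v} 𝕜, StrongRep 𝕜 G X} (hU : U ∈ R.reps) :
    ‖U.2.integrated μ f‖ ≤ R.sigma f :=
  le_ciSup (R.bddAbove f) (⟨U, hU⟩ : R.reps)

theorem RepClass.sigma_nonneg (R : RepClass.{w, u, v} 𝕜 G) (f : ConvAlgebra 𝕜 G μ) :
    0 ≤ R.sigma f :=
  Real.iSup_nonneg fun _ => norm_nonneg _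

theorem RepClass.sigma_le (R : RepClass.{w, u, v} 𝕜 G) {f : ConvAlgebra 𝕜 G μ} {C : ℝ}
    (h : ∀ U ∈ R.reps, ‖U.2.integrated μ f‖ ≤ C) : R.sigma f ≤ C := by
  have := R.nonempty.to_subtype
  exact ciSup_le fun U => h U.1 U.2

/-- `σ` as a seminorm. -/
def RepClass.seminorm (μ : Measure G) [μ.IsHaarMeasure] (R : RepClass.{w, u, v} 𝕜 G) :
    Seminorm 𝕜 (ConvAlgebra 𝕜 G μ) :=
  Seminorm.of R.sigma
    (fun f g => R.sigma_le fun U hU => by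
      rw [map_add]
      exact (norm_add_le _ _).trans (add_le_add (R.norm_le_sigma f hU) (R.norm_le_sigma g hU)))
    (fun c f => by
      simp only [sigma, map_smul, norm_smul]
      exact (Real.mul_iSup_of_nonneg (norm_nonneg c) _).symm)

theorem RepClass.sigma_mul_le (R : RepClass.{w, u, v} 𝕜 G) (f g : ConvAlgebra 𝕜 G μ) :
    R.sigma (f * g) ≤ R.sigma f * R.sigma g :=
  R.sigma_le fun U hU => by
    rw [map_mul]
    exact (norm_mul_le _ _).trans (mul_le_mul (R.norm_le_sigma f hU) (R.norm_le_sigma g hU)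
      (norm_nonneg _) (R.sigma_nonneg f))

/-- The convolution algebra, equipped with the seminorm `σ`. -/
def PreCrossed (μ : Measure G) [μ.IsHaarMeasure] (_R : RepClass.{w, u, v} 𝕜 G) :
    Type (max u w) :=
  ConvAlgebra 𝕜 G μ

variable (R : RepClass.{w, u, v} 𝕜 G)

instance : NonUnitalRing (PreCrossed μ R) :=
  inferInstanceAs (NonUnitalRing (ConvAlgebra 𝕜 G μ))

instance : Module 𝕜 (PreCrossed μ R) :=
  inferInstanceAs (Module 𝕜 (ConvAlgebra 𝕜 G μ))

instance : IsScalarTower 𝕜 (PreCrossed μ R) (PreCrossed μ R) :=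
  inferInstanceAs (IsScalarTower 𝕜 (ConvAlgebra 𝕜 G μ) (ConvAlgebra 𝕜 G μ))

instance : SMulCommClass 𝕜 (PreCrossed μ R) (PreCrossed μ R) :=
  inferInstanceAs (SMulCommClass 𝕜 (ConvAlgebra 𝕜 G μ) (ConvAlgebra 𝕜 G μ))

/-- The seminorm `σ` as a group seminorm on `PreCrossed`. -/
def PreCrossed.groupSeminorm : AddGroupSeminorm (PreCrossed μ R) :=
  (R.seminorm μ).toAddGroupSeminorm

instance : SeminormedAddCommGroup (PreCrossed μ R) :=
  (PreCrossed.groupSeminorm R).toSeminormedAddCommGroup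

theorem PreCrossed.norm_def (f : PreCrossed μ R) : ‖f‖ = R.sigma (μ := μ) f := rfl

instance : NonUnitalSeminormedRing (PreCrossed μ R) :=
  { (inferInstance : SeminormedAddCommGroup (PreCrossed μ R)),
    (inferInstance : NonUnitalRing (PreCrossed μ R)) with
    norm_mul_le := R.sigma_mul_le (μ := μ) }

instance : NormedSpace 𝕜 (PreCrossed μ R) where
  norm_smul_le c f := (map_smul_eq_mul (R.seminorm μ) c f).le

/-- The crossed product: the (Hausdorff) completion of the convolution algebra with respect to
the seminorm `σ`, that is, the completion of its quotient by the kernel of `σ` in the norm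
induced by `σ`. -/
def CrossedProduct (μ : Measure G) [μ.IsHaarMeasure] (R : RepClass.{w, u, v} 𝕜 G) :
    Type (max u w) :=
  UniformSpace.Completion (PreCrossed μ R)

namespace CrossedProduct

instance : NormedAddCommGroup (CrossedProduct μ R) :=
  inferInstanceAs (NormedAddCommGroup (UniformSpace.Completion (PreCrossed μ R)))

instance : NormedSpace 𝕜 (CrossedProduct μ R) :=
  inferInstanceAs (NormedSpace 𝕜 (UniformSpace.Completion (PreCrossed μ R)))

instance : CompleteSpace (CrossedProduct μ R) :=
  inferInstanceAs (CompleteSpace (UniformSpace.Completion (PreCrossed μ R)))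

/-- The canonical linear map from the convolution algebra into the crossed product. -/
def qLin (μ : Measure G) [μ.IsHaarMeasure] (R : RepClass.{w, u, v} 𝕜 G) :
    ConvAlgebra 𝕜 G μ →ₗ[𝕜] CrossedProduct μ R :=
  (UniformSpace.Completion.toComplₗᵢ :
    PreCrossed μ R →ₗᵢ[𝕜] UniformSpace.Completion (PreCrossed μ R)).toLinearMap

theorem norm_qLin (f : ConvAlgebra 𝕜 G μ) : ‖qLin μ R f‖ = R.sigma f :=
  (UniformSpace.Completion.toComplₗᵢ :
    PreCrossed μ R →ₗᵢ[𝕜] UniformSpace.Completion (PreCrossed μ R)).norm_map f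

theorem denseRange_qLin : DenseRange (qLin μ R) :=
  UniformSpace.Completion.denseRange_coe (α := PreCrossed μ R)

/-- Left multiplication by an element of the convolution algebra, extended to the completion. -/
def leftMul (f : ConvAlgebra 𝕜 G μ) : CrossedProduct μ R →L[𝕜] CrossedProduct μ R :=
  ((qLin μ R).comp (LinearMap.mulLeft 𝕜 f)).extendOfNorm (qLin μ R)

theorem leftMul_bound (f g : ConvAlgebra 𝕜 G μ) :
    ‖((qLin μ R).comp (LinearMap.mulLeft 𝕜 f)) g‖ ≤ R.sigma f * ‖qLin μ R g‖ := by
  rw [norm_qLin]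
  exact (norm_qLin R (f * g)).trans_le (R.sigma_mul_le f g)

theorem leftMul_q (f g : ConvAlgebra 𝕜 G μ) :
    leftMul R f (qLin μ R g) = qLin μ R (f * g) :=
  LinearMap.extendOfNorm_eq (denseRange_qLin R) ⟨_, leftMul_bound R f⟩ g

theorem norm_leftMul_le (f : ConvAlgebra 𝕜 G μ) : ‖leftMul R f‖ ≤ R.sigma f :=
  LinearMap.opNorm_extendOfNorm_le (denseRange_qLin R) (R.sigma_nonneg f) (leftMul_bound R f)

/-- Two bounded operators on the crossed product that agree on the image of the convolution
algebra are equal. -/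
theorem clm_ext {E : Type*} [NormedAddCommGroup E] [NormedSpace 𝕜 E]
    {S T : CrossedProduct μ R →L[𝕜] E} (h : ∀ f, S (qLin μ R f) = T (qLin μ R f)) : S = T :=
  DFunLike.coe_injective ((denseRange_qLin R).equalizer S.continuous T.continuous (funext h))

/-- `leftMul` as a linear map. -/
def leftMulLin : ConvAlgebra 𝕜 G μ →ₗ[𝕜] (CrossedProduct μ R →L[𝕜] CrossedProduct μ R) where
  toFun := leftMul R
  map_add' f g := clm_ext R fun h => by
    simp only [_root_.add_apply, leftMul_q, add_mul, map_add]
  map_smul' c f := clm_ext R fun h => by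
    simp only [_root_.smul_apply, leftMul_q, smul_mul_assoc, map_smul, RingHom.id_apply]

theorem leftMulLin_bound (f : ConvAlgebra 𝕜 G μ) :
    ‖leftMulLin R f‖ ≤ 1 * ‖qLin μ R f‖ := by
  rw [one_mul, norm_qLin]
  exact norm_leftMul_le R f

/-- The multiplication of the crossed product, as a bounded bilinear map: the continuous
extension of the convolution product. -/
def mulCLM : CrossedProduct μ R →L[𝕜] CrossedProduct μ R →L[𝕜] CrossedProduct μ R :=
  (leftMulLin R).extendOfNorm (qLin μ R)

instance : Mul (CrossedProduct μ R) where
  mul a b := mulCLM R a b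

theorem mul_def (a b : CrossedProduct μ R) : a * b = mulCLM R a b := rfl

theorem q_mul (f g : ConvAlgebra 𝕜 G μ) :
    qLin μ R f * qLin μ R g = qLin μ R (f * g) := by
  rw [mul_def, mulCLM, LinearMap.extendOfNorm_eq (denseRange_qLin R) ⟨_, leftMulLin_bound R⟩ f]
  exact leftMul_q R f g

theorem norm_mul_le_aux (a b : CrossedProduct μ R) : ‖a * b‖ ≤ ‖a‖ * ‖b‖ := by
  have h := LinearMap.norm_extendOfNorm_apply_le (denseRange_qLin R) 1 (leftMulLin_bound R) a
  rw [one_mul] at h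
  exact ((mulCLM R a).le_opNorm b).trans (mul_le_mul_of_nonneg_right h (norm_nonneg b))

theorem continuous_mul_aux :
    Continuous fun p : CrossedProduct μ R × CrossedProduct μ R => p.1 * p.2 :=
  (mulCLM R).continuous₂

/-- The crossed product is a Banach algebra. -/
instance : NonUnitalNormedRing (CrossedProduct μ R) :=
  { (inferInstance : NormedAddCommGroup (CrossedProduct μ R)),
    (inferInstance : Mul (CrossedProduct μ R)) with
    norm_mul_le := norm_mul_le_aux R
    left_distrib := fun a b c => by simp only [mul_def, map_add]
    right_distrib := fun a b c => by simp only [mul_def, map_add, _root_.add_apply]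
    zero_mul := fun a => by simp only [mul_def, map_zero, _root_.zero_apply]
    mul_zero := fun a => by simp only [mul_def, map_zero]
    mul_assoc := fun a b c => by
      have hc := continuous_mul_aux (μ := μ) R
      refine (denseRange_qLin R).induction_on₃ (p := fun a b c => a * b * c = a * (b * c))
        (isClosed_eq ?_ ?_) (fun f g h => ?_) a b c
      · exact hc.comp ((hc.comp (continuous_fst.prodMk
          (continuous_fst.comp continuous_snd))).prodMk (continuous_snd.comp continuous_snd))
      · exact hc.comp (continuous_fst.prodMk (hc.comp ((continuous_fst.comp continuous_snd).prodMk
          (continuous_snd.comp continuous_snd))))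
      · simp only [q_mul, mul_assoc] }

instance : IsScalarTower 𝕜 (CrossedProduct μ R) (CrossedProduct μ R) where
  smul_assoc c a b := by
    simp only [smul_eq_mul, mul_def, map_smul, _root_.smul_apply]

instance : SMulCommClass 𝕜 (CrossedProduct μ R) (CrossedProduct μ R) where
  smul_comm c a b := by
    simp only [smul_eq_mul, mul_def, map_smul]

/-- The canonical homomorphism `q` from the convolution algebra into the crossed product. -/
def q (μ : Measure G) [μ.IsHaarMeasure] (R : RepClass.{w, u, v} 𝕜 G) :
    ConvAlgebra 𝕜 G μ →ₙₐ[𝕜] CrossedProduct μ R where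
  toFun := qLin μ R
  map_smul' := map_smul (qLin μ R)
  map_zero' := map_zero (qLin μ R)
  map_add' := map_add (qLin μ R)
  map_mul' f g := (q_mul R f g).symm

end CrossedProduct

/-! ### The representation of the crossed product induced by a group representation -/

variable {R} {X : BanachSpace.{w, v} 𝕜}

/-- The integrated form of `U` is bounded with respect to the seminorm `σ` of the class `R`. -/
def StrongRep.IsContinuousFor (μ : Measure G) [μ.IsHaarMeasure] (R : RepClass.{w, u, v} 𝕜 G)
    (U : StrongRep 𝕜 G X) : Prop :=
  ∃ C : ℝ, ∀ f : ConvAlgebra 𝕜 G μ, ‖U.integrated μ f‖ ≤ C * R.sigma f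

theorem StrongRep.isContinuousFor_of_mem {U : Σ X : BanachSpace.{w, v} 𝕜, StrongRep 𝕜 G X}
    (hU : U ∈ R.reps) : U.2.IsContinuousFor μ R :=
  ⟨1, fun f => by rw [one_mul]; exact R.norm_le_sigma f hU⟩

/-- The integrated form as a linear map. -/
def StrongRep.integratedLin (μ : Measure G) [μ.IsHaarMeasure] (U : StrongRep 𝕜 G X) :
    ConvAlgebra 𝕜 G μ →ₗ[𝕜] (X →L[𝕜] X) :=
  (U.integrated μ : ConvAlgebra 𝕜 G μ →ₗ[𝕜] (X →L[𝕜] X))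

/-- The continuous extension of the integrated form to the crossed product. -/
def StrongRep.inducedCLM (μ : Measure G) [μ.IsHaarMeasure] (R : RepClass.{w, u, v} 𝕜 G)
    (U : StrongRep 𝕜 G X) : CrossedProduct μ R →L[𝕜] (X →L[𝕜] X) :=
  (U.integratedLin μ).extendOfNorm (CrossedProduct.q μ R : ConvAlgebra 𝕜 G μ →ₗ[𝕜] _)

theorem StrongRep.inducedCLM_q {U : StrongRep 𝕜 G X} (hU : U.IsContinuousFor μ R)
    (f : ConvAlgebra 𝕜 G μ) :
    U.inducedCLM μ R (CrossedProduct.q μ R f) = U.integrated μ f := by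
  obtain ⟨C, hC⟩ := hU
  refine LinearMap.extendOfNorm_eq
    (e := (CrossedProduct.q μ R : ConvAlgebra 𝕜 G μ →ₗ[𝕜] CrossedProduct μ R))
    (CrossedProduct.denseRange_qLin R) ⟨C, fun f => ?_⟩ f
  exact (hC f).trans_eq (congrArg (C * ·) (CrossedProduct.norm_qLin R f).symm)

/-- The bounded representation of the crossed product induced by an `R`-continuous `U`; it is
determined by `q(f) ↦ U(f)`. -/
def StrongRep.induced (U : StrongRep 𝕜 G X) (hU : U.IsContinuousFor μ R) :
    AlgRep 𝕜 (CrossedProduct μ R) X where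
  toFun := U.inducedCLM μ R
  map_smul' := map_smul (U.inducedCLM μ R)
  map_zero' := map_zero (U.inducedCLM μ R)
  map_add' := map_add (U.inducedCLM μ R)
  map_mul' a b := by
    have hc := (U.inducedCLM μ R).continuous
    refine (CrossedProduct.denseRange_qLin R).induction_on₂
      (p := fun a b => U.inducedCLM μ R (a * b) = U.inducedCLM μ R a * U.inducedCLM μ R b)
      (isClosed_eq ?_ ?_) (fun f g => ?_) a b
    · exact hc.comp (CrossedProduct.continuous_mul_aux R)
    · exact (hc.comp continuous_fst).mul (hc.comp continuous_snd)
    · have h := U.inducedCLM_q hU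
      calc _ = U.inducedCLM μ R (CrossedProduct.q μ R (f * g)) :=
            congrArg (U.inducedCLM μ R) (CrossedProduct.q_mul R f g)
        _ = U.inducedCLM μ R (CrossedProduct.q μ R f) *
            U.inducedCLM μ R (CrossedProduct.q μ R g) := by
              rw [h, h, h, map_mul (U.integrated μ)]

theorem StrongRep.induced_q {U : StrongRep 𝕜 G X} (hU : U.IsContinuousFor μ R)
    (f : ConvAlgebra 𝕜 G μ) :
    U.induced hU (CrossedProduct.q μ R f) = U.integrated μ f :=
  U.inducedCLM_q hU f

end Crossed

/-! ### Group Banach algebras -/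

section GroupAlgebra

variable {𝕜 : Type w} [RCLike 𝕜] (G : Type u) [Group G] [TopologicalSpace G]

/-- All pairs `(X, U)` with `X` in the class `𝓧` and `U` an isometric strongly continuous
representation of `G` on `X`. -/
def isometricReps (𝓧 : Set (BanachSpace.{w, v} 𝕜)) :
    Set (Σ X : BanachSpace.{w, v} 𝕜, StrongRep 𝕜 G X) :=
  {U | U.1 ∈ 𝓧 ∧ U.2.IsIsometric}

/-- The isometric strongly continuous representations in spaces from a non-empty class `𝓧` form
a non-empty uniformly bounded class. -/
def isometricClass (𝓧 : Set (BanachSpace.{w, v} 𝕜)) (h𝓧 : 𝓧.Nonempty) :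
    RepClass.{w, u, v} 𝕜 G where
  reps := isometricReps G 𝓧
  nonempty := by
    obtain ⟨X, hX⟩ := h𝓧
    exact ⟨⟨X, StrongRep.trivial 𝕜 G X⟩, hX, fun r x => by
      simp [StrongRep.op, StrongRep.trivial]⟩
  bounded := by
    refine ⟨fun _ => 1, fun K _ => ⟨1, ?_⟩, fun U hU r => ?_⟩
    · rintro _ ⟨_, _, rfl⟩
      exact le_rfl
    · refine ContinuousLinearMap.opNorm_le_bound _ (by simp) fun x => ?_
      rw [hU.2 r x]
      simp

variable {G} [IsTopologicalGroup G] [LocallyCompactSpace G] [MeasurableSpace G] [BorelSpace G]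

/-- The group Banach algebra of `G` associated with the non-empty class `𝓧`. -/
abbrev GroupBanachAlgebra (μ : Measure G) [μ.IsHaarMeasure] (𝓧 : Set (BanachSpace.{w, v} 𝕜))
    (h𝓧 : 𝓧.Nonempty) : Type (max u w) :=
  CrossedProduct μ (isometricClass G 𝓧 h𝓧)

/-- The representation of the group Banach algebra induced by an isometric strongly continuous
representation of `G` on a space from `𝓧`. -/
def isometricReps.induced (μ : Measure G) [μ.IsHaarMeasure] {𝓧 : Set (BanachSpace.{w, v} 𝕜)}
    (h𝓧 : 𝓧.Nonempty) (U : isometricReps G 𝓧) :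
    AlgRep 𝕜 (GroupBanachAlgebra μ 𝓧 h𝓧) U.1.1 :=
  StrongRep.induced (μ := μ) (R := isometricClass G 𝓧 h𝓧) U.1.2
    (StrongRep.isContinuousFor_of_mem (R := isometricClass G 𝓧 h𝓧) U.2)

end GroupAlgebra

end BanachCrossed

end

/-!
Left translation by `r` on `C_c(G)` extends to a bounded operator `L_r` on the crossed product that
commutes with right multiplications, and bumps concentrating at `1` form a bounded left approximate
unit. A bounded nondegenerate representation `T` of a Banach algebra with such a unit extends to
left centralizers by `T(L)(T(a)x) = T(La)x`, so that `U_r = T(L_r)` defines a strongly continuous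
representation of `G`. Its integrated form is `T ∘ q`, because the orbit maps `a ↦ T(a)x`
intertwine `L` with `U`, and the integrated form of `L` is left multiplication. In the converse
direction, `U_r = lim U(L_r u)` as the bump `u` concentrates at `1`, so the operators `U(f)`
determine `U`, its closed invariant subspaces and its intertwining operators.
-/

universe v'

noncomputable section

open MeasureTheory Function Set Filter Topology
open scoped NNReal Pointwise TensorProduct

namespace BanachCrossed

/-! ### Extending representations to left centralizers -/

section Centralizers

variable {𝕜 : Type w} [RCLike 𝕜]

theorem continuous_clm_apply_of_dense_span {P E F : Type*} [TopologicalSpace P]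
    [NormedAddCommGroup E] [NormedSpace 𝕜 E] [NormedAddCommGroup F] [NormedSpace 𝕜 F]
    {W : P → E →L[𝕜] F} (hW : ∀ p, ∃ M, ∀ᶠ p' in 𝓝 p, ‖W p'‖ ≤ M)
    {S : Set E} (hS : Dense (Submodule.span 𝕜 S : Set E))
    (hc : ∀ x ∈ S, Continuous fun p => W p x) (x : E) : Continuous fun p => W p x := by
  have hspan : ∀ y ∈ Submodule.span 𝕜 S, Continuous fun p => W p y := fun y hy => by
    induction hy using Submodule.span_induction with
    | mem y hy => exact hc y hy
    | zero => simpa only [map_zero] using continuous_const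
    | add y z _ _ hy hz =>
      simp only [map_add]
      exact hy.add hz
    | smul c y _ hy =>
      simp only [map_smul]
      exact hy.const_smul c
  refine continuous_of_locally_uniform_approx_of_continuousAt fun p U hU => ?_
  obtain ⟨ε, hε, hεU⟩ := Metric.mem_uniformity_dist.1 hU
  obtain ⟨M, hM⟩ := hW p
  have hM0 : 0 ≤ M := (norm_nonneg _).trans hM.self_of_nhds
  obtain ⟨y, hxy, hy⟩ := Metric.dense_iff.1 hS x (ε / (M + 1)) (by positivity)
  refine ⟨_, hM, fun p => W p y, (hspan y hy).continuousAt, fun p' hp' => hεU ?_⟩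
  calc dist (W p' x) (W p' y) ≤ M * dist x y := by
        rw [dist_eq_norm, dist_eq_norm, ← map_sub]
        exact (W p').le_of_opNorm_le hp' _
    _ ≤ (M + 1) * dist x y := by gcongr; exact le_add_of_nonneg_right zero_le_one
    _ < ε := by rw [dist_comm, ← lt_div_iff₀' (by positivity)]; exact hxy

variable {A : Type u} [NonUnitalNormedRing A] [NormedSpace 𝕜 A]

/-- A left approximate unit of `A` eventually bounded by `M`, encoded as a filter on `A`. -/
structure IsBoundedLeftApproxUnit (l : Filter A) (M : ℝ) : Prop where
  neBot : l.NeBot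
  tendsto_mul (a : A) : Tendsto (fun e => e * a) l (𝓝 a)
  eventually_norm_le : ∀ᶠ e in l, ‖e‖ ≤ M

/-- A left centralizer of `A` is a bounded operator commuting with all right multiplications. -/
def IsLeftCentralizer (L : A →L[𝕜] A) : Prop :=
  ∀ a b, L (a * b) = L a * b

namespace AlgRep

variable {X : BanachSpace.{w, v} 𝕜}

/-- The evaluation `a ⊗ x ↦ T(a)x`; its range is the linear span of all `T(a)x`. -/
def evalTensor (T : AlgRep 𝕜 A X) : A ⊗[𝕜] X →ₗ[𝕜] X :=
  TensorProduct.lift ((ContinuousLinearMap.coeLM 𝕜).comp (T : A →ₗ[𝕜] (X →L[𝕜] X)))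

theorem evalTensor_tmul (T : AlgRep 𝕜 A X) (a : A) (x : X) : T.evalTensor (a ⊗ₜ x) = T a x := rfl

theorem denseRange_evalTensor {T : AlgRep 𝕜 A X} (hn : T.IsNondegenerate) :
    DenseRange T.evalTensor := by
  have hle : Submodule.span 𝕜 {y : X | ∃ (a : A) (x : X), T a x = y} ≤
      LinearMap.range T.evalTensor := by
    rw [Submodule.span_le]
    rintro _ ⟨a, x, rfl⟩
    exact ⟨a ⊗ₜ x, rfl⟩
  exact hn.mono hle

/-- The extension of a representation `T` of `A` to left centralizers, determined by
`T(L)(T(a)x) = T(La)x`. The value is junk unless `T` is bounded and nondegenerate and `A` has a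
bounded left approximate unit. -/
def centralizerOp (T : AlgRep 𝕜 A X) (L : A →L[𝕜] A) : X →L[𝕜] X :=
  (T.evalTensor ∘ₗ L.toLinearMap.rTensor X).extendOfNorm T.evalTensor

variable {T : AlgRep 𝕜 A X} {C : ℝ≥0}

theorem continuous_apply_const (hT : LipschitzWith C T) (x : X) : Continuous fun a => T a x :=
  hT.continuous.clm_apply continuous_const

variable {l : Filter A} {M : ℝ} {L : A →L[𝕜] A}

theorem tendsto_centralizer_evalTensor (hT : LipschitzWith C T) (hl : IsBoundedLeftApproxUnit l M)
    (hL : IsLeftCentralizer L) (t : A ⊗[𝕜] X) :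
    Tendsto (fun e => T (L e) (T.evalTensor t)) l
      (𝓝 (T.evalTensor (L.toLinearMap.rTensor X t))) := by
  induction t with
  | zero => simpa only [map_zero] using tendsto_const_nhds
  | tmul a x =>
    have hc : Continuous fun a => T (L a) x := (continuous_apply_const hT x).comp L.continuous
    refine ((hc.tendsto a).comp (hl.tendsto_mul a)).congr fun e => ?_
    simp only [comp_apply, hL e a, map_mul, evalTensor_tmul, mul_apply_eq_comp]
  | add t t' h h' => simpa only [map_add] using h.add h'

theorem norm_evalTensor_rTensor_le (hT : LipschitzWith C T) (hl : IsBoundedLeftApproxUnit l M)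
    (hL : IsLeftCentralizer L) (t : A ⊗[𝕜] X) :
    ‖T.evalTensor (L.toLinearMap.rTensor X t)‖ ≤ C * (‖L‖ * M) * ‖T.evalTensor t‖ := by
  have := hl.neBot
  refine le_of_tendsto (tendsto_centralizer_evalTensor hT hl hL t).norm ?_
  filter_upwards [hl.eventually_norm_le] with e he
  have hTL : ‖T (L e)‖ ≤ C * (‖L‖ * M) :=
    calc ‖T (L e)‖ ≤ C * ‖L e‖ := hT.norm_le_mul (map_zero T) _
      _ ≤ C * (‖L‖ * M) := by gcongr; exact L.le_opNorm_of_le he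
  exact (T (L e)).le_of_opNorm_le hTL _

theorem centralizerOp_apply (hT : LipschitzWith C T) (hn : T.IsNondegenerate)
    (hl : IsBoundedLeftApproxUnit l M) (hL : IsLeftCentralizer L) (a : A) (x : X) :
    T.centralizerOp L (T a x) = T (L a) x := by
  unfold centralizerOp
  have h := LinearMap.extendOfNorm_eq (f := T.evalTensor ∘ₗ L.toLinearMap.rTensor X)
    (denseRange_evalTensor hn) ⟨_, norm_evalTensor_rTensor_le hT hl hL⟩ (a ⊗ₜ x)
  rwa [evalTensor_tmul, LinearMap.comp_apply, LinearMap.rTensor_tmul, evalTensor_tmul] at h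

theorem norm_centralizerOp_apply_le (hT : LipschitzWith C T) (hn : T.IsNondegenerate)
    (hl : IsBoundedLeftApproxUnit l M) (hL : IsLeftCentralizer L) (x : X) :
    ‖T.centralizerOp L x‖ ≤ C * (‖L‖ * M) * ‖x‖ := by
  unfold centralizerOp
  exact LinearMap.norm_extendOfNorm_apply_le (f := T.evalTensor ∘ₗ L.toLinearMap.rTensor X)
    (denseRange_evalTensor hn) _ (norm_evalTensor_rTensor_le hT hl hL) x

theorem IsNondegenerate.clm_ext (hn : T.IsNondegenerate) {E : Type*} [NormedAddCommGroup E]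
    [NormedSpace 𝕜 E] {S S' : X →L[𝕜] E} (h : ∀ a x, S (T a x) = S' (T a x)) : S = S' :=
  ContinuousLinearMap.ext_on hn (by rintro _ ⟨a, x, rfl⟩; exact h a x)

end AlgRep

end Centralizers

/-! ### Translations and bumps in the convolution algebra -/

namespace ConvAlgebra

section Bumps

variable {𝕜 : Type w} [RCLike 𝕜] {G : Type u} [TopologicalSpace G] [MeasurableSpace G]
  {μ : Measure G}

/-- A bump on `N` is a test function supported in `N` with integral and `L¹`-norm one. -/
structure IsBump (u : ConvAlgebra 𝕜 G μ) (N : Set G) : Prop where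
  tsupport_subset : tsupport u ⊆ N
  integral_eq_one : ∫ s, u s ∂μ = 1
  integral_norm_eq_one : ∫ s, ‖u s‖ ∂μ = 1

variable [Group G]

variable (𝕜 μ) in
/-- The filter on test functions generated by the sets of bumps on neighbourhoods of `1`. -/
def bumpFilter : Filter (ConvAlgebra 𝕜 G μ) :=
  (𝓝 (1 : G)).lift' fun N => {u | u.IsBump N}

theorem eventually_isBump {N : Set G} (hN : N ∈ 𝓝 1) : ∀ᶠ u in bumpFilter 𝕜 μ, u.IsBump N :=
  mem_lift' hN

end Bumps

section TestFunctions

variable {𝕜 : Type w} [RCLike 𝕜] {G : Type u} [Group G] [TopologicalSpace G]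
  [IsTopologicalGroup G] [LocallyCompactSpace G] [MeasurableSpace G] [BorelSpace G]
  {μ : Measure G}

/-- Left translation `(L_r f)(s) = f(r⁻¹ s)`. -/
def translate (r : G) : ConvAlgebra 𝕜 G μ →ₗ[𝕜] ConvAlgebra 𝕜 G μ where
  toFun f :=
    ({ toFun := fun s => f (r⁻¹ * s)
       continuous_toFun := f.continuous.comp (continuous_const.mul continuous_id)
       hasCompactSupport' := f.hasCompactSupport.comp_homeomorph (Homeomorph.mulLeft r⁻¹) } :
      CompactlySupportedContinuousMap G 𝕜)
  map_add' _ _ := rfl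
  map_smul' _ _ := rfl

theorem translate_apply (r : G) (f : ConvAlgebra 𝕜 G μ) (s : G) :
    translate r f s = f (r⁻¹ * s) := rfl

theorem translate_one (f : ConvAlgebra 𝕜 G μ) : translate 1 f = f := by
  ext s
  rw [translate_apply, inv_one, one_mul]

theorem translate_mul (r t : G) (f : ConvAlgebra 𝕜 G μ) :
    translate (r * t) f = translate r (translate t f) := by
  ext s
  simp only [translate_apply, mul_inv_rev, mul_assoc]

theorem translate_conv [μ.IsHaarMeasure] (r : G) (f g : ConvAlgebra 𝕜 G μ) :
    translate r (f * g) = translate r f * g := by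
  ext s
  rw [translate_apply, mul_apply, mul_apply,
    ← integral_mul_left_eq_self (fun t => translate r f t * g (t⁻¹ * s)) r]
  simp only [translate_apply, mul_inv_rev, inv_mul_cancel_left, mul_assoc]

theorem translate_apply_eq_zero {f : ConvAlgebra 𝕜 G μ} {K : Set G} {r s : G} (hr : r ∈ K)
    (hs : s ∉ K * tsupport f) : translate r f s = 0 := by
  rw [translate_apply]
  exact image_eq_zero_of_notMem_tsupport fun h =>
    hs ⟨r, hr, r⁻¹ * s, h, mul_inv_cancel_left r s⟩

theorem tsupport_translate_sub_subset {f : ConvAlgebra 𝕜 G μ} {K : Set G} (hK : IsCompact K)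
    {r t : G} (hr : r ∈ K) (ht : t ∈ K) :
    tsupport (translate r f - translate t f) ⊆ K * tsupport f := by
  refine closure_minimal (fun s hs => ?_) (isClosed_tsupport f |>.mul_left_of_isCompact hK)
  by_contra h
  exact hs (show translate r f s - translate t f s = 0 by
    rw [translate_apply_eq_zero hr h, translate_apply_eq_zero ht h, sub_zero])

theorem tendsto_integral_norm_translate_sub [IsFiniteMeasureOnCompacts μ]
    (f : ConvAlgebra 𝕜 G μ) (r : G) :
    Tendsto (fun t => ∫ s, ‖(translate t f - translate r f) s‖ ∂μ) (𝓝 r) (𝓝 0) := by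
  obtain ⟨K, hK, hrK⟩ := exists_compact_mem_nhds r
  have hc : ContinuousOn (fun t => ∫ s, ‖f (t⁻¹ * s) - f (r⁻¹ * s)‖ ∂μ) K := by
    refine continuousOn_integral_of_compact_support (hK.mul f.hasCompactSupport)
      (Continuous.continuousOn ?_) fun t s ht hs => ?_
    · exact ((f.continuous.comp (continuous_fst.inv.mul continuous_snd)).sub
        (f.continuous.comp (continuous_const.mul continuous_snd))).norm
    · simp only [← translate_apply, translate_apply_eq_zero ht hs,
        translate_apply_eq_zero (mem_of_mem_nhds hrK) hs, sub_zero, norm_zero]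
  have h := (hc.continuousAt hrK).tendsto
  simp only [sub_self, norm_zero, integral_zero] at h
  exact h

theorem exists_isBump [IsFiniteMeasureOnCompacts μ] [μ.IsOpenPosMeasure] {r : G} {N : Set G}
    (hN : N ∈ 𝓝 r) : ∃ u : ConvAlgebra 𝕜 G μ, u.IsBump N := by
  obtain ⟨φ, hφr, hcs, hφN, hφ⟩ := exists_continuousMap_one_of_isCompact_subset_isOpen
    (isCompact_singleton (x := r)) isOpen_interior
    (by simpa only [singleton_subset_iff, mem_interior_iff_mem_nhds] using hN)
  set c := ∫ s, φ s ∂μ with hc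
  have hpos : 0 < c :=
    φ.continuous.integral_pos_of_hasCompactSupport_nonneg_nonzero hcs (fun s => (hφ s).1)
      (x := r) (by rw [hφr rfl]; exact one_ne_zero)
  have hsupp : support (fun s => ((c⁻¹ * φ s : ℝ) : 𝕜)) ⊆ support φ := fun s hs h =>
    hs (by simp only [h, mul_zero, RCLike.ofReal_zero])
  let u : ConvAlgebra 𝕜 G μ :=
    ({ toFun := fun s => ((c⁻¹ * φ s : ℝ) : 𝕜)
       continuous_toFun := RCLike.continuous_ofReal.comp (continuous_const.mul φ.continuous)
       hasCompactSupport' := HasCompactSupport.mono hcs hsupp } :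
      CompactlySupportedContinuousMap G 𝕜)
  have hu : ∀ s, u s = ((c⁻¹ * φ s : ℝ) : 𝕜) := fun _ => rfl
  have hint : ∫ s, c⁻¹ * φ s ∂μ = 1 := by
    rw [integral_const_mul, ← hc, inv_mul_cancel₀ hpos.ne']
  refine ⟨u, (closure_mono hsupp).trans (hφN.trans interior_subset), ?_, ?_⟩
  · simp only [hu]
    rw [integral_ofReal, hint, RCLike.ofReal_one]
  · have hnorm : ∀ s, ‖u s‖ = c⁻¹ * φ s := fun s => by
      rw [hu, RCLike.norm_of_nonneg (mul_nonneg (inv_nonneg.2 hpos.le) (hφ s).1)]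
    simp only [hnorm, hint]

instance [IsFiniteMeasureOnCompacts μ] [μ.IsOpenPosMeasure] : (bumpFilter 𝕜 μ).NeBot :=
  (lift'_neBot_iff fun _ _ hNN' _ hu => { hu with
    tsupport_subset := hu.tsupport_subset.trans hNN' }).2 fun _ hN => exists_isBump hN

section Integrals

variable [IsFiniteMeasureOnCompacts μ] {E : Type*} [NormedAddCommGroup E] [NormedSpace 𝕜 E]
  [NormedSpace ℝ E] [CompleteSpace E] {F : G → E}

theorem IsBump.norm_integral_smul_sub_le {u : ConvAlgebra 𝕜 G μ} {N : Set G} (hu : u.IsBump N)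
    (hF : Continuous F) {y : E} {ε : ℝ} (hε : ∀ s ∈ N, ‖F s - y‖ ≤ ε) :
    ‖∫ s, u s • F s ∂μ - y‖ ≤ ε := by
  have hint : Integrable u μ := u.continuous.integrable_of_hasCompactSupport u.hasCompactSupport
  calc ‖∫ s, u s • F s ∂μ - y‖ = ‖∫ s, u s • (F s - y) ∂μ‖ := by
        simp_rw [smul_sub]
        rw [integral_sub (u.integrable_smul hF) (u.integrable_smul continuous_const),
          integral_smul_const, hu.integral_eq_one, one_smul]
    _ ≤ ∫ s, ‖u s‖ * ε ∂μ := by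
        refine norm_integral_le_of_norm_le (hint.norm.mul_const _) (.of_forall fun s => ?_)
        rw [norm_smul]
        by_cases hs : s ∈ N
        · exact mul_le_mul_of_nonneg_left (hε s hs) (norm_nonneg _)
        · rw [image_eq_zero_of_notMem_tsupport fun h => hs (hu.tsupport_subset h), norm_zero,
            zero_mul, zero_mul]
    _ = ε := by rw [integral_mul_const, hu.integral_norm_eq_one, one_mul]

theorem tendsto_integral_smul_bumpFilter (hF : Continuous F) :
    Tendsto (fun u : ConvAlgebra 𝕜 G μ => ∫ s, u s • F s ∂μ) (bumpFilter 𝕜 μ) (𝓝 (F 1)) := by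
  refine Metric.tendsto_nhds.2 fun ε hε => ?_
  have hN : F ⁻¹' Metric.closedBall (F 1) (ε / 2) ∈ 𝓝 1 :=
    hF.continuousAt (Metric.closedBall_mem_nhds (F 1) (half_pos hε))
  filter_upwards [eventually_isBump hN] with u hu
  rw [dist_eq_norm]
  exact (hu.norm_integral_smul_sub_le hF fun s hs => mem_closedBall_iff_norm.1 hs).trans_lt
    (half_lt_self hε)

end Integrals

end TestFunctions

end ConvAlgebra

/-! ### Recovering a group representation from its integrated form -/

namespace StrongRep

section Algebra

variable {𝕜 : Type w} [RCLike 𝕜] {G : Type u} [Group G] [TopologicalSpace G]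
  {X : BanachSpace.{w, v} 𝕜}

theorem op_mul_apply (U : StrongRep 𝕜 G X) (r t : G) (x : X) :
    U.op (r * t) x = U.op r (U.op t x) := by
  rw [op, map_mul, Units.val_mul, mul_apply_eq_comp]
  rfl

theorem op_one_apply (U : StrongRep 𝕜 G X) (x : X) : U.op 1 x = x := by
  rw [op, map_one, Units.val_one, one_apply_eq_self]

theorem ext_op {U V : StrongRep 𝕜 G X} (h : ∀ r, U.op r = V.op r) : U = V :=
  StrongRep.ext (MonoidHom.ext fun r => Units.ext (h r))

theorem IsIsometric.norm_op_le_one {U : StrongRep 𝕜 G X} (hU : U.IsIsometric) (r : G) :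
    ‖U.op r‖ ≤ 1 :=
  ContinuousLinearMap.opNorm_le_bound _ zero_le_one fun x => by rw [hU r x, one_mul]

theorem isIsometric_of_norm_op_apply_le {U : StrongRep 𝕜 G X}
    (hU : ∀ r x, ‖U.op r x‖ ≤ ‖x‖) : U.IsIsometric := fun r x => by
  refine le_antisymm (hU r x) ?_
  calc ‖x‖ = ‖U.op r⁻¹ (U.op r x)‖ := by rw [← op_mul_apply, inv_mul_cancel, op_one_apply]
    _ ≤ ‖U.op r x‖ := hU _ _

end Algebra

section Integrated

variable {𝕜 : Type w} [RCLike 𝕜] {G : Type u} [Group G] [TopologicalSpace G]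
  [IsTopologicalGroup G] [LocallyCompactSpace G] [MeasurableSpace G] [BorelSpace G]
  {μ : Measure G} [μ.IsHaarMeasure] {X : BanachSpace.{w, v} 𝕜}

open ConvAlgebra

theorem norm_integrated_le (U : StrongRep 𝕜 G X) (f : ConvAlgebra 𝕜 G μ) {M : ℝ} (hM₀ : 0 ≤ M)
    (hM : ∀ s ∈ tsupport f, ‖U.op s‖ ≤ M) : ‖U.integrated μ f‖ ≤ (∫ s, ‖f s‖ ∂μ) * M :=
  ContinuousLinearMap.opNorm_le_bound _
    (mul_nonneg (integral_nonneg fun _ => norm_nonneg _) hM₀) (U.norm_integral_le f hM)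

theorem map_integrated_of_intertwines {Y : BanachSpace.{w, v'} 𝕜} {U : StrongRep 𝕜 G X}
    {V : StrongRep 𝕜 G Y} {Φ : X →L[𝕜] Y} (hΦ : ∀ r x, Φ (U.op r x) = V.op r (Φ x))
    (f : ConvAlgebra 𝕜 G μ) (x : X) : Φ (U.integrated μ f x) = V.integrated μ f (Φ x) :=
  calc Φ (U.integrated μ f x) = ∫ s, Φ (f s • U.op s x) ∂μ :=
        (Φ.integral_comp_comm (f.integrable_smul (U.continuous_apply x))).symm
    _ = V.integrated μ f (Φ x) := by simp only [map_smul, hΦ, integrated_apply]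

theorem integrated_translate (U : StrongRep 𝕜 G X) (r : G) (f : ConvAlgebra 𝕜 G μ) (x : X) :
    U.integrated μ (translate r f) x = U.op r (U.integrated μ f x) :=
  calc U.integrated μ (translate r f) x = ∫ s, translate r f (r * s) • U.op (r * s) x ∂μ :=
        (integral_mul_left_eq_self (fun s => translate r f s • U.op s x) r).symm
    _ = ∫ s, U.op r (f s • U.op s x) ∂μ := by
        simp only [ConvAlgebra.translate_apply, inv_mul_cancel_left, op_mul_apply, map_smul]
    _ = U.op r (U.integrated μ f x) :=
        (U.op r).integral_comp_comm (f.integrable_smul (U.continuous_apply x))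

theorem integrated_mem {U : StrongRep 𝕜 G X} {Z : Submodule 𝕜 X}
    (hZ : Z ∈ U.closedInvariantSubspaces) (f : ConvAlgebra 𝕜 G μ) {z : X} (hz : z ∈ Z) :
    U.integrated μ f z ∈ Z := by
  have := hZ.1.completeSpace_coe
  have hF : Continuous fun s => (⟨U.op s z, hZ.2 s z hz⟩ : Z) :=
    (U.continuous_apply z).subtype_mk _
  rw [integrated_apply]
  exact (Z.subtypeL.integral_comp_comm (f.integrable_smul hF)).symm ▸ Subtype.property _

theorem tendsto_integrated_bumpFilter (U : StrongRep 𝕜 G X) (x : X) :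
    Tendsto (fun u => U.integrated μ u x) (bumpFilter 𝕜 μ) (𝓝 x) := by
  simpa only [integrated_apply, op_one_apply] using
    tendsto_integral_smul_bumpFilter (𝕜 := 𝕜) (μ := μ) (F := fun s => U.op s x)
      (U.continuous_apply x)

theorem tendsto_integrated_translate_bumpFilter (U : StrongRep 𝕜 G X) (r : G) (x : X) :
    Tendsto (fun u => U.integrated μ (translate r u) x) (bumpFilter 𝕜 μ) (𝓝 (U.op r x)) := by
  simp only [integrated_translate]
  exact (U.op r).continuous.continuousAt.tendsto.comp (U.tendsto_integrated_bumpFilter x)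

theorem mem_closedInvariantSubspaces_iff_integrated {U : StrongRep 𝕜 G X} {Z : Submodule 𝕜 X} :
    Z ∈ U.closedInvariantSubspaces ↔
      IsClosed (Z : Set X) ∧ ∀ f : ConvAlgebra 𝕜 G μ, ∀ z ∈ Z, U.integrated μ f z ∈ Z :=
  ⟨fun hZ => ⟨hZ.1, fun f _ hz => integrated_mem hZ f hz⟩, fun hZ => ⟨hZ.1, fun r z hz =>
    hZ.1.mem_of_tendsto (U.tendsto_integrated_translate_bumpFilter (μ := μ) r z)
      (.of_forall fun _ => hZ.2 _ z hz)⟩⟩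

theorem mem_intertwiners_iff_integrated {Y : BanachSpace.{w, v} 𝕜} {U : StrongRep 𝕜 G X}
    {V : StrongRep 𝕜 G Y} {Φ : X →L[𝕜] Y} :
    Φ ∈ U.intertwiners V ↔
      ∀ f : ConvAlgebra 𝕜 G μ, (V.integrated μ f).comp Φ = Φ.comp (U.integrated μ f) := by
  refine ⟨fun hΦ f => ContinuousLinearMap.ext fun x => ?_,
    fun hΦ r => ContinuousLinearMap.ext fun x => ?_⟩
  · exact (map_integrated_of_intertwines (fun r y => (DFunLike.congr_fun (hΦ r) y).symm) f x).symm
  · refine tendsto_nhds_unique (V.tendsto_integrated_translate_bumpFilter (μ := μ) r (Φ x)) ?_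
    refine ((Φ.continuous.tendsto _).comp
      (U.tendsto_integrated_translate_bumpFilter (μ := μ) r x)).congr fun u => ?_
    exact (DFunLike.congr_fun (hΦ (translate r u)) x).symm

theorem integrated_injective : Injective (integrated (𝕜 := 𝕜) (X := X) μ) := fun U V h => by
  refine ext_op fun r => ContinuousLinearMap.ext fun x => ?_
  refine tendsto_nhds_unique (U.tendsto_integrated_translate_bumpFilter (μ := μ) r x) ?_
  rw [h]
  exact V.tendsto_integrated_translate_bumpFilter r x

end Integrated

end StrongRep

/-! ### Translations on the crossed product -/

namespace RepClass

section Growth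

variable {𝕜 : Type w} [RCLike 𝕜] {G : Type u} [Group G] [TopologicalSpace G]
  (R : RepClass.{w, u, v} 𝕜 G)

/-- The pointwise smallest function that bounds the class `R`, `r ↦ sup ‖U_r‖` over all `U`
in `R`. -/
def growth (r : G) : ℝ :=
  ⨆ U : R.reps, ‖U.1.2.op r‖

theorem norm_op_le_growth {U : Σ X : BanachSpace.{w, v} 𝕜, StrongRep 𝕜 G X} (hU : U ∈ R.reps)
    (r : G) : ‖U.2.op r‖ ≤ R.growth r := by
  obtain ⟨ν, -, hν⟩ := R.bounded
  exact le_ciSup (f := fun U : R.reps => ‖U.1.2.op r‖)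
    ⟨ν r, by rintro _ ⟨V, rfl⟩; exact hν _ V.2 r⟩ ⟨U, hU⟩

theorem growth_nonneg (r : G) : 0 ≤ R.growth r :=
  Real.iSup_nonneg fun _ => norm_nonneg _

variable {R}

theorem growth_le {r : G} {C : ℝ} (h : ∀ U ∈ R.reps, ‖U.2.op r‖ ≤ C) : R.growth r ≤ C := by
  have := R.nonempty.to_subtype
  exact ciSup_le fun U => h U.1 U.2

variable (R) in
theorem exists_growth_le_of_isCompact {K : Set G} (hK : IsCompact K) :
    ∃ M, ∀ r ∈ K, R.growth r ≤ M := by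
  obtain ⟨ν, hνK, hν⟩ := R.bounded
  obtain ⟨M, hM⟩ := hνK K hK
  exact ⟨M, fun r hr => growth_le fun U hU => (hν U hU r).trans (hM (mem_image_of_mem ν hr))⟩

variable (R) in
theorem exists_eventually_growth_le [WeaklyLocallyCompactSpace G] (r : G) :
    ∃ M, ∀ᶠ t in 𝓝 r, R.growth t ≤ M := by
  obtain ⟨K, hK, hrK⟩ := exists_compact_mem_nhds r
  obtain ⟨M, hM⟩ := R.exists_growth_le_of_isCompact hK
  exact ⟨M, mem_of_superset hrK hM⟩

end Growth

section Sigma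

variable {𝕜 : Type w} [RCLike 𝕜] {G : Type u} [Group G] [TopologicalSpace G]
  [IsTopologicalGroup G] [LocallyCompactSpace G] [MeasurableSpace G] [BorelSpace G]
  {μ : Measure G} [μ.IsHaarMeasure] (R : RepClass.{w, u, v} 𝕜 G)

theorem sigma_le_of_growth_le {f : ConvAlgebra 𝕜 G μ} {M : ℝ} (hM₀ : 0 ≤ M)
    (hM : ∀ s ∈ tsupport f, R.growth s ≤ M) : R.sigma f ≤ (∫ s, ‖f s‖ ∂μ) * M :=
  R.sigma_le fun U hU =>
    U.2.norm_integrated_le f hM₀ fun s hs => (R.norm_op_le_growth hU s).trans (hM s hs)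

theorem sigma_translate_le (r : G) (f : ConvAlgebra 𝕜 G μ) :
    R.sigma (ConvAlgebra.translate r f) ≤ R.growth r * R.sigma f :=
  R.sigma_le fun U hU => ContinuousLinearMap.opNorm_le_bound _
    (mul_nonneg (R.growth_nonneg r) (R.sigma_nonneg f)) fun x =>
    calc ‖U.2.integrated μ (ConvAlgebra.translate r f) x‖ = ‖U.2.op r (U.2.integrated μ f x)‖ := by
          rw [StrongRep.integrated_translate]
      _ ≤ R.growth r * (R.sigma f * ‖x‖) :=
          (U.2.op r).le_of_opNorm_le_of_le (R.norm_op_le_growth hU r)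
            ((U.2.integrated μ f).le_of_opNorm_le (R.norm_le_sigma f hU) x)
      _ = R.growth r * R.sigma f * ‖x‖ := (mul_assoc _ _ _).symm

end Sigma

end RepClass

section Crossed

variable {𝕜 : Type w} [RCLike 𝕜] {G : Type u} [Group G] [TopologicalSpace G]
  [IsTopologicalGroup G] [LocallyCompactSpace G] [MeasurableSpace G] [BorelSpace G]
  {μ : Measure G} [μ.IsHaarMeasure] (R : RepClass.{w, u, v} 𝕜 G)

namespace CrossedProduct

theorem norm_q (f : ConvAlgebra 𝕜 G μ) : ‖q μ R f‖ = R.sigma f :=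
  norm_qLin R f

theorem denseRange_q : DenseRange (q μ R) :=
  denseRange_qLin R

variable (μ) in
/-- Left translation by `r`, extended from test functions to the crossed product. -/
def translate (r : G) : CrossedProduct μ R →L[𝕜] CrossedProduct μ R :=
  (qLin μ R ∘ₗ ConvAlgebra.translate r).extendOfNorm (qLin μ R)

theorem norm_qLin_translate_le (r : G) (f : ConvAlgebra 𝕜 G μ) :
    ‖(qLin μ R ∘ₗ ConvAlgebra.translate r) f‖ ≤ R.growth r * ‖qLin μ R f‖ := by
  rw [LinearMap.comp_apply, norm_qLin, norm_qLin]
  exact R.sigma_translate_le r f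

theorem translate_q (r : G) (f : ConvAlgebra 𝕜 G μ) :
    translate μ R r (q μ R f) = q μ R (ConvAlgebra.translate r f) := by
  unfold translate
  exact LinearMap.extendOfNorm_eq (f := qLin μ R ∘ₗ ConvAlgebra.translate r) (denseRange_qLin R)
    ⟨_, norm_qLin_translate_le R r⟩ f

theorem norm_translate_le (r : G) : ‖translate μ R r‖ ≤ R.growth r := by
  unfold translate
  exact LinearMap.opNorm_extendOfNorm_le (f := qLin μ R ∘ₗ ConvAlgebra.translate r)
    (denseRange_qLin R) (R.growth_nonneg r) (norm_qLin_translate_le R r)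

theorem translate_one : translate μ R 1 = ContinuousLinearMap.id 𝕜 (CrossedProduct μ R) :=
  clm_ext R fun f => (translate_q R 1 f).trans (congrArg (q μ R) (ConvAlgebra.translate_one f))

theorem translate_mul (r t : G) : translate μ R (r * t) = translate μ R r * translate μ R t :=
  clm_ext R fun f => by
    change translate μ R (r * t) (q μ R f) = translate μ R r (translate μ R t (q μ R f))
    simp only [translate_q, ConvAlgebra.translate_mul]

theorem isLeftCentralizer_translate (r : G) : IsLeftCentralizer (translate μ R r) := by
  refine (denseRange_q R).induction_on₂ (p := fun a b => translate μ R r (a * b) =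
    translate μ R r a * b) (isClosed_eq ?_ ?_) fun f g => ?_
  · exact (translate μ R r).continuous.comp continuous_mul
  · exact ((translate μ R r).continuous.comp continuous_fst).mul continuous_snd
  · rw [← map_mul, translate_q, translate_q, ConvAlgebra.translate_conv, map_mul]

theorem continuous_q_translate (f : ConvAlgebra 𝕜 G μ) :
    Continuous fun r => q μ R (ConvAlgebra.translate r f) := by
  refine continuous_iff_continuousAt.2 fun r => tendsto_iff_norm_sub_tendsto_zero.2 ?_
  obtain ⟨K, hK, hrK⟩ := exists_compact_mem_nhds r
  obtain ⟨M, hM⟩ := R.exists_growth_le_of_isCompact (hK.mul f.hasCompactSupport)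
  have hbound : ∀ᶠ t in 𝓝 r,
      ‖q μ R (ConvAlgebra.translate t f) - q μ R (ConvAlgebra.translate r f)‖ ≤
        (∫ s, ‖(ConvAlgebra.translate t f - ConvAlgebra.translate r f) s‖ ∂μ) * max M 0 := by
    filter_upwards [hrK] with t ht
    rw [← map_sub, norm_q]
    refine R.sigma_le_of_growth_le (le_max_right _ _) fun s hs => le_max_of_le_left (hM s ?_)
    exact ConvAlgebra.tsupport_translate_sub_subset hK ht (mem_of_mem_nhds hrK) hs
  refine squeeze_zero' (.of_forall fun _ => norm_nonneg _) hbound ?_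
  simpa only [zero_mul] using (ConvAlgebra.tendsto_integral_norm_translate_sub f r).mul_const _

theorem continuous_translate_apply (a : CrossedProduct μ R) :
    Continuous fun r => translate μ R r a := by
  refine continuous_clm_apply_of_dense_span (𝕜 := 𝕜) (S := range (q μ R)) (fun r => ?_)
    ((denseRange_q R).mono Submodule.subset_span) ?_ a
  · obtain ⟨M, hM⟩ := R.exists_eventually_growth_le r
    exact ⟨M, hM.mono fun t => (norm_translate_le R t).trans⟩
  · rintro _ ⟨f, rfl⟩
    simpa only [translate_q] using continuous_q_translate R f

variable (μ) in
/-- The left regular representation of `G`, acting on the crossed product by translations. -/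
def leftRegular : StrongRep 𝕜 G ⟨CrossedProduct μ R⟩ where
  hom := MonoidHom.toHomUnits
    { toFun := translate μ R
      map_one' := translate_one R
      map_mul' := translate_mul R }
  continuous_apply := continuous_translate_apply R

end CrossedProduct

end Crossed

/-! ### Induced representations -/

section Induced

variable {𝕜 : Type w} [RCLike 𝕜] {G : Type u} [Group G] [TopologicalSpace G]
  [IsTopologicalGroup G] [LocallyCompactSpace G] [MeasurableSpace G] [BorelSpace G]
  {μ : Measure G} [μ.IsHaarMeasure] {R : RepClass.{w, u, v} 𝕜 G}

open CrossedProduct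

namespace StrongRep

variable {X Y : BanachSpace.{w, v} 𝕜} {U : StrongRep 𝕜 G X}

theorem continuous_induced (hU : U.IsContinuousFor μ R) : Continuous (U.induced hU) :=
  (U.inducedCLM μ R).continuous

theorem norm_induced_le (hU : U.IsContinuousFor μ R) {C : ℝ}
    (hC : ∀ f : ConvAlgebra 𝕜 G μ, ‖U.integrated μ f‖ ≤ C * R.sigma f)
    (a : CrossedProduct μ R) : ‖U.induced hU a‖ ≤ C * ‖a‖ := by
  refine (denseRange_q R).induction_on (p := fun a => ‖U.induced hU a‖ ≤ C * ‖a‖) a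
    (isClosed_le (continuous_induced hU).norm (continuous_const.mul continuous_norm)) fun f => ?_
  rw [induced_q, norm_q]
  exact hC f

theorem isContractive_induced_of_mem {U : Σ X : BanachSpace.{w, v} 𝕜, StrongRep 𝕜 G X}
    (hU : U ∈ R.reps) : (U.2.induced (isContinuousFor_of_mem (μ := μ) hU)).IsContractive :=
  fun a => by
    refine (norm_induced_le _ (fun f => ?_) a).trans_eq (one_mul _)
    rw [one_mul]
    exact R.norm_le_sigma f hU

theorem op_induced (hU : U.IsContinuousFor μ R) (r : G) (a : CrossedProduct μ R) (x : X) :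
    U.op r (U.induced hU a x) = U.induced hU (translate μ R r a) x := by
  have hc : Continuous fun a => U.induced hU a x :=
    (continuous_induced hU).clm_apply continuous_const
  refine (denseRange_q R).induction_on (p := fun a => U.op r (U.induced hU a x) =
    U.induced hU (translate μ R r a) x) a (isClosed_eq ((U.op r).continuous.comp hc)
      (hc.comp (translate μ R r).continuous)) fun f => ?_
  rw [translate_q, induced_q, induced_q, integrated_translate]

theorem isNondegenerate_induced (hU : U.IsContinuousFor μ R) : (U.induced hU).IsNondegenerate :=
  fun x => mem_closure_of_tendsto (U.tendsto_integrated_bumpFilter (μ := μ) x)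
    (.of_forall fun u => Submodule.subset_span ⟨q μ R u, x, by rw [induced_q]⟩)

theorem closedInvariantSubspaces_induced (hU : U.IsContinuousFor μ R) :
    (U.induced hU).closedInvariantSubspaces = U.closedInvariantSubspaces := by
  ext Z
  refine Iff.trans (and_congr_right fun hZ => ?_)
    (mem_closedInvariantSubspaces_iff_integrated (μ := μ)).symm
  refine ⟨fun h f => induced_q hU f ▸ h (q μ R f), fun h a z hz => ?_⟩
  refine (denseRange_q R).induction_on (p := fun a => U.induced hU a z ∈ Z) a
    (hZ.preimage ((continuous_induced hU).clm_apply continuous_const)) fun f => ?_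
  exact (induced_q hU f).symm ▸ h f z hz

theorem intertwiners_induced {V : StrongRep 𝕜 G Y} (hU : U.IsContinuousFor μ R)
    (hV : V.IsContinuousFor μ R) :
    (U.induced hU).intertwiners (V.induced hV) = U.intertwiners V := by
  ext Φ
  refine Iff.trans ?_ (mem_intertwiners_iff_integrated (μ := μ)).symm
  refine ⟨fun h f => induced_q hU f ▸ induced_q hV f ▸ h (q μ R f), fun h a => ?_⟩
  refine (denseRange_q R).induction_on
    (p := fun a => (V.induced hV a).comp Φ = Φ.comp (U.induced hU a)) a
    (isClosed_eq ((continuous_induced hV).clm_comp continuous_const)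
      (continuous_const.clm_comp (continuous_induced hU))) fun f => ?_
  rw [induced_q, induced_q, h f]

theorem induced_inj {V : StrongRep 𝕜 G X} (hU : U.IsContinuousFor μ R)
    (hV : V.IsContinuousFor μ R) : U.induced hU = V.induced hV ↔ U = V := by
  refine ⟨fun h => integrated_injective (μ := μ) (NonUnitalAlgHom.ext fun f => ?_), ?_⟩
  · rw [← induced_q hU, h, induced_q hV]
  · rintro rfl
    rfl

end StrongRep

namespace CrossedProduct

theorem norm_le_of_forall_norm_induced_le {a : CrossedProduct μ R} {C : ℝ}
    (h : ∀ U (hU : U ∈ R.reps),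
      ‖U.2.induced (StrongRep.isContinuousFor_of_mem (μ := μ) hU) a‖ ≤ C) : ‖a‖ ≤ C := by
  refine le_of_forall_pos_le_add fun ε hε => ?_
  obtain ⟨f, hf⟩ := (denseRange_q R).exists_dist_lt a (half_pos hε)
  rw [dist_eq_norm] at hf
  have hσ : R.sigma f ≤ C + ε / 2 := R.sigma_le fun U hU => by
    have hUR := StrongRep.isContinuousFor_of_mem (μ := μ) hU
    have hdist : ‖U.2.induced hUR a - U.2.integrated μ f‖ ≤ ε / 2 := by
      rw [← StrongRep.induced_q hUR f, ← map_sub]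
      exact (StrongRep.isContractive_induced_of_mem hU _).trans hf.le
    linarith [norm_le_norm_add_norm_sub (U.2.induced hUR a) (U.2.integrated μ f), h U hU]
  linarith [norm_le_norm_add_norm_sub' a (q μ R f), norm_q R f]

theorem eq_of_forall_induced_eq {a b : CrossedProduct μ R}
    (h : ∀ U (hU : U ∈ R.reps), U.2.induced (StrongRep.isContinuousFor_of_mem (μ := μ) hU) a =
      U.2.induced (StrongRep.isContinuousFor_of_mem (μ := μ) hU) b) : a = b := by
  rw [← sub_eq_zero, ← norm_le_zero_iff]
  exact norm_le_of_forall_norm_induced_le fun U hU => by rw [map_sub, h U hU, sub_self, norm_zero]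

variable (R)

theorem integrated_leftRegular (f : ConvAlgebra 𝕜 G μ) (a : CrossedProduct μ R) :
    (leftRegular μ R).integrated μ f a = q μ R f * a := by
  refine eq_of_forall_induced_eq fun U hU => ContinuousLinearMap.ext fun x => ?_
  have hUR := StrongRep.isContinuousFor_of_mem (μ := μ) hU
  have h := StrongRep.map_integrated_of_intertwines (U := leftRegular μ R) (V := U.2)
    (Φ := (U.2.inducedCLM μ R).flip x)
    (fun r b => (StrongRep.op_induced hUR r b x).symm) f a
  calc U.2.induced hUR ((leftRegular μ R).integrated μ f a) x
      = U.2.integrated μ f (U.2.induced hUR a x) := h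
    _ = U.2.induced hUR (q μ R f * a) x := by
      rw [map_mul, StrongRep.induced_q, mul_apply_eq_comp]

theorem isBoundedLeftApproxUnit_map_q {M : ℝ} (hM : ∀ᶠ r in 𝓝 1, R.growth r ≤ M) :
    IsBoundedLeftApproxUnit ((ConvAlgebra.bumpFilter 𝕜 μ).map (q μ R)) M where
  neBot := inferInstance
  tendsto_mul a := tendsto_map'_iff.2 <|
    ((leftRegular μ R).tendsto_integrated_bumpFilter a).congr fun u =>
      integrated_leftRegular R u a
  eventually_norm_le := by
    rw [eventually_map]
    filter_upwards [ConvAlgebra.eventually_isBump hM] with u hu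
    rw [norm_q]
    refine (R.sigma_le_of_growth_le ((R.growth_nonneg 1).trans hM.self_of_nhds)
      hu.tsupport_subset).trans_eq ?_
    rw [hu.integral_norm_eq_one, one_mul]

end CrossedProduct

end Induced

/-! ### Disintegration -/

section Disintegration

variable {𝕜 : Type w} [RCLike 𝕜] {G : Type u} [Group G] [TopologicalSpace G]
  [IsTopologicalGroup G] [LocallyCompactSpace G] [MeasurableSpace G] [BorelSpace G]
  {μ : Measure G} [μ.IsHaarMeasure] {R : RepClass.{w, u, v} 𝕜 G}

open CrossedProduct

namespace AlgRep

variable {X : BanachSpace.{w, v} 𝕜} {T : AlgRep 𝕜 (CrossedProduct μ R) X} {C : ℝ≥0}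

theorem centralizerOp_translate_apply (hT : LipschitzWith C T) (hn : T.IsNondegenerate) (r : G)
    (a : CrossedProduct μ R) (x : X) :
    T.centralizerOp (translate μ R r) (T a x) = T (translate μ R r a) x := by
  obtain ⟨M, hM⟩ := R.exists_eventually_growth_le 1
  exact centralizerOp_apply hT hn (isBoundedLeftApproxUnit_map_q R hM)
    (isLeftCentralizer_translate R r) a x

theorem norm_centralizerOp_translate_apply_le (hT : LipschitzWith C T) (hn : T.IsNondegenerate)
    {M : ℝ} (hM : ∀ᶠ r in 𝓝 1, R.growth r ≤ M) (r : G) (x : X) :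
    ‖T.centralizerOp (translate μ R r) x‖ ≤ C * (R.growth r * M) * ‖x‖ := by
  have hM₀ : 0 ≤ M := (R.growth_nonneg 1).trans hM.self_of_nhds
  refine (norm_centralizerOp_apply_le hT hn (isBoundedLeftApproxUnit_map_q R hM)
    (isLeftCentralizer_translate R r) x).trans ?_
  gcongr
  exact norm_translate_le R r

theorem continuous_centralizerOp_translate_apply (hT : LipschitzWith C T)
    (hn : T.IsNondegenerate) (x : X) :
    Continuous fun r => T.centralizerOp (translate μ R r) x := by
  refine continuous_clm_apply_of_dense_span (fun r => ?_) hn ?_ x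
  · obtain ⟨M, hM⟩ := R.exists_eventually_growth_le 1
    obtain ⟨M', hM'⟩ := R.exists_eventually_growth_le r
    have hM₀ : 0 ≤ M := (R.growth_nonneg 1).trans hM.self_of_nhds
    refine ⟨C * (M' * M), hM'.mono fun t ht => ContinuousLinearMap.opNorm_le_bound _
      (by have := (R.growth_nonneg t).trans ht; positivity) fun y => ?_⟩
    refine (norm_centralizerOp_translate_apply_le hT hn hM t y).trans ?_
    gcongr
  · rintro _ ⟨a, x, rfl⟩
    simp only [centralizerOp_translate_apply hT hn]
    exact (continuous_apply_const hT x).comp (continuous_translate_apply R a)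

/-- The representation of `G` underlying a bounded nondegenerate representation `T` of the crossed
product, determined by `U_r T(a)x = T(L_r a)x`. -/
def groupRep (T : AlgRep 𝕜 (CrossedProduct μ R) X) (hT : LipschitzWith C T)
    (hn : T.IsNondegenerate) : StrongRep 𝕜 G X where
  hom := MonoidHom.toHomUnits
    { toFun := fun r => T.centralizerOp (translate μ R r)
      map_one' := hn.clm_ext fun a x => by
        rw [centralizerOp_translate_apply hT hn, CrossedProduct.translate_one,
          ContinuousLinearMap.id_apply, one_apply_eq_self]
      map_mul' := fun r t => hn.clm_ext fun a x => by
        rw [centralizerOp_translate_apply hT hn, CrossedProduct.translate_mul,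
          mul_apply_eq_comp, mul_apply_eq_comp, centralizerOp_translate_apply hT hn,
          centralizerOp_translate_apply hT hn] }
  continuous_apply := continuous_centralizerOp_translate_apply hT hn

theorem groupRep_op_apply (hT : LipschitzWith C T) (hn : T.IsNondegenerate) (r : G)
    (a : CrossedProduct μ R) (x : X) :
    (T.groupRep hT hn).op r (T a x) = T (translate μ R r a) x :=
  centralizerOp_translate_apply hT hn r a x

theorem norm_groupRep_op_apply_le (hT : LipschitzWith C T) (hn : T.IsNondegenerate) {M : ℝ}
    (hM : ∀ᶠ r in 𝓝 1, R.growth r ≤ M) (r : G) (x : X) :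
    ‖(T.groupRep hT hn).op r x‖ ≤ C * (R.growth r * M) * ‖x‖ :=
  norm_centralizerOp_translate_apply_le hT hn hM r x

theorem integrated_groupRep (hT : LipschitzWith C T) (hn : T.IsNondegenerate)
    (f : ConvAlgebra 𝕜 G μ) : (T.groupRep hT hn).integrated μ f = T (q μ R f) := by
  refine hn.clm_ext fun a x => ?_
  let orbit : CrossedProduct μ R →L[𝕜] X :=
    { toFun := fun a => T a x
      map_add' := fun a b => by rw [map_add, add_apply]
      map_smul' := fun c a => by rw [map_smul, smul_apply, RingHom.id_apply]
      cont := continuous_apply_const hT x }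
  calc (T.groupRep hT hn).integrated μ f (T a x) = T ((leftRegular μ R).integrated μ f a) x :=
        (StrongRep.map_integrated_of_intertwines (U := leftRegular μ R) (Φ := orbit)
          (fun r b => (groupRep_op_apply hT hn r b x).symm) f a).symm
    _ = T (q μ R f) (T a x) := by rw [integrated_leftRegular, map_mul, mul_apply_eq_comp]

theorem isContinuousFor_groupRep (hT : LipschitzWith C T) (hn : T.IsNondegenerate) :
    (T.groupRep hT hn).IsContinuousFor μ R :=
  ⟨C, fun f => by
    rw [integrated_groupRep, ← norm_q]
    exact hT.norm_le_mul (map_zero T) _⟩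

theorem induced_groupRep (hT : LipschitzWith C T) (hn : T.IsNondegenerate) :
    (T.groupRep hT hn).induced (isContinuousFor_groupRep hT hn) = T := by
  have h := isContinuousFor_groupRep hT hn
  refine NonUnitalAlgHom.ext fun a => ?_
  refine (denseRange_q R).induction_on (p := fun a => (T.groupRep hT hn).induced h a = T a) a
    (isClosed_eq (StrongRep.continuous_induced h) hT.continuous) fun f => ?_
  rw [StrongRep.induced_q, integrated_groupRep]

end AlgRep

end Disintegration

/-! ### Isometric representations -/

section Isometric

variable {𝕜 : Type w} [RCLike 𝕜] {G : Type u} [Group G] [TopologicalSpace G]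
  {𝓧 : Set (BanachSpace.{w, v} 𝕜)} (h𝓧 : 𝓧.Nonempty)

theorem growth_isometricClass_le_one (r : G) : (isometricClass G 𝓧 h𝓧).growth r ≤ 1 :=
  RepClass.growth_le fun _ hU => hU.2.norm_op_le_one r

variable [IsTopologicalGroup G] [LocallyCompactSpace G] [MeasurableSpace G] [BorelSpace G]
  (μ : Measure G) [μ.IsHaarMeasure]

theorem isometricReps.induced_mem_ndContractiveReps (U : isometricReps G 𝓧) :
    ⟨U.1.1, isometricReps.induced μ h𝓧 U⟩ ∈
      ndContractiveReps (GroupBanachAlgebra μ 𝓧 h𝓧) 𝓧 :=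
  ⟨U.2.1, StrongRep.isNondegenerate_induced
      (StrongRep.isContinuousFor_of_mem (R := isometricClass G 𝓧 h𝓧) U.2),
    StrongRep.isContractive_induced_of_mem (R := isometricClass G 𝓧 h𝓧) U.2⟩

theorem isometricReps.induced_injective :
    Injective fun U : isometricReps G 𝓧 =>
      (⟨U.1.1, isometricReps.induced μ h𝓧 U⟩ :
        Σ X : BanachSpace.{w, v} 𝕜, AlgRep 𝕜 (GroupBanachAlgebra μ 𝓧 h𝓧) X) := by
  rintro ⟨⟨X, U⟩, hU⟩ ⟨⟨Y, V⟩, hV⟩ h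
  obtain ⟨rfl, h⟩ := Sigma.mk.inj h
  obtain rfl := (StrongRep.induced_inj _ _).1 (eq_of_heq h)
  rfl

variable {μ h𝓧} {X : BanachSpace.{w, v} 𝕜}
  {T : AlgRep 𝕜 (GroupBanachAlgebra μ 𝓧 h𝓧) X}

theorem AlgRep.IsContractive.lipschitzWith (hT : T.IsContractive) : LipschitzWith 1 T :=
  AddMonoidHomClass.lipschitz_of_bound_nnnorm T 1 fun a => by
    rw [one_mul]
    exact hT a

theorem AlgRep.IsContractive.isIsometric_groupRep (hT : T.IsContractive)
    (hn : T.IsNondegenerate) : (T.groupRep hT.lipschitzWith hn).IsIsometric :=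
  StrongRep.isIsometric_of_norm_op_apply_le fun r x => by
    have h := norm_groupRep_op_apply_le hT.lipschitzWith hn
      (.of_forall (growth_isometricClass_le_one h𝓧)) r x
    rw [NNReal.coe_one, one_mul, mul_one] at h
    exact h.trans (mul_le_of_le_one_left (norm_nonneg x) (growth_isometricClass_le_one h𝓧 r))

theorem isometricReps.exists_induced_eq {T : Σ X : BanachSpace.{w, v} 𝕜,
      AlgRep 𝕜 (GroupBanachAlgebra μ 𝓧 h𝓧) X}
    (hT : T ∈ ndContractiveReps (GroupBanachAlgebra μ 𝓧 h𝓧) 𝓧) :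
    ∃ U : isometricReps G 𝓧, ⟨U.1.1, isometricReps.induced μ h𝓧 U⟩ = T := by
  obtain ⟨hX, hn, hc⟩ := hT
  exact ⟨⟨⟨T.1, T.2.groupRep hc.lipschitzWith hn⟩, hX, hc.isIsometric_groupRep hn⟩,
    Sigma.ext rfl (heq_of_eq (AlgRep.induced_groupRep hc.lipschitzWith hn))⟩

end Isometric

end BanachCrossed

end

theorem theoremt_general {𝕜 : Type w} [RCLike 𝕜] {G : Type u} [Group G] [TopologicalSpace G]
    [IsTopologicalGroup G] [LocallyCompactSpace G] [MeasurableSpace G] [BorelSpace G]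
    (μ : MeasureTheory.Measure G) [μ.IsHaarMeasure]
    (𝓧 : Set (BanachCrossed.BanachSpace.{w, v} 𝕜)) (h𝓧 : 𝓧.Nonempty) :
    Set.BijOn
      (fun U : BanachCrossed.isometricReps G 𝓧 =>
        (⟨U.1.1, BanachCrossed.isometricReps.induced μ h𝓧 U⟩ :
          Σ X : BanachCrossed.BanachSpace.{w, v} 𝕜,
            BanachCrossed.AlgRep 𝕜 (BanachCrossed.GroupBanachAlgebra μ 𝓧 h𝓧) X))
      Set.univ
      (BanachCrossed.ndContractiveReps (BanachCrossed.GroupBanachAlgebra μ 𝓧 h𝓧) 𝓧) ∧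
    (∀ U : BanachCrossed.isometricReps G 𝓧,
      (BanachCrossed.isometricReps.induced μ h𝓧 U).closedInvariantSubspaces =
        U.1.2.closedInvariantSubspaces) ∧
    (∀ U V : BanachCrossed.isometricReps G 𝓧,
      (BanachCrossed.isometricReps.induced μ h𝓧 U).intertwiners
          (BanachCrossed.isometricReps.induced μ h𝓧 V) =
        U.1.2.intertwiners V.1.2) := by
  have hR := fun U : BanachCrossed.isometricReps G 𝓧 =>
    BanachCrossed.StrongRep.isContinuousFor_of_mem (μ := μ)
      (R := BanachCrossed.isometricClass G 𝓧 h𝓧) U.2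
  refine ⟨⟨fun U _ => BanachCrossed.isometricReps.induced_mem_ndContractiveReps h𝓧 μ U,
    (BanachCrossed.isometricReps.induced_injective h𝓧 μ).injOn, fun T hT => ?_⟩,
    fun U => BanachCrossed.StrongRep.closedInvariantSubspaces_induced (hR U),
    fun U V => BanachCrossed.StrongRep.intertwiners_induced (hR U) (hR V)⟩
  obtain ⟨U, rfl⟩ := BanachCrossed.isometricReps.exists_induced_eq hT
  exact ⟨U, Set.mem_univ U, rfl⟩

theorem theoremt {𝕜 : Type w} [RCLike 𝕜] {G : Type u} [Group G] [TopologicalSpace G]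
    [IsTopologicalGroup G] [LocallyCompactSpace G] [T2Space G] [MeasurableSpace G] [BorelSpace G]
    (μ : MeasureTheory.Measure G) [μ.IsHaarMeasure]
    (𝓧 : Set (BanachCrossed.BanachSpace.{w, v} 𝕜)) (h𝓧 : 𝓧.Nonempty) :
    Set.BijOn
      (fun U : BanachCrossed.isometricReps G 𝓧 =>
        (⟨U.1.1, BanachCrossed.isometricReps.induced μ h𝓧 U⟩ :
          Σ X : BanachCrossed.BanachSpace.{w, v} 𝕜,
            BanachCrossed.AlgRep 𝕜 (BanachCrossed.GroupBanachAlgebra μ 𝓧 h𝓧) X))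
      Set.univ
      (BanachCrossed.ndContractiveReps (BanachCrossed.GroupBanachAlgebra μ 𝓧 h𝓧) 𝓧) ∧
    (∀ U : BanachCrossed.isometricReps G 𝓧,
      (BanachCrossed.isometricReps.induced μ h𝓧 U).closedInvariantSubspaces =
        U.1.2.closedInvariantSubspaces) ∧
    (∀ U V : BanachCrossed.isometricReps G 𝓧,
      (BanachCrossed.isometricReps.induced μ h𝓧 U).intertwiners
          (BanachCrossed.isometricReps.induced μ h𝓧 V) =
        U.1.2.intertwiners V.1.2) :=
  theoremt_general μ 𝓧 h𝓧
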